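/- Let $N\ge 1$. All C*-algebras and morphisms are unital, $\otimes$ is the minimal tensor product, and noncommutative compact spaces $X$ are given by a C*-algebra $C(X)$ with a family of coordinates; $X\subset Y$ means that there is a quotient map $C(Y)\to C(X)$ mapping coordinates to coordinates, $X=Y$ means that there is such an isomorphism, and $C(X\cap Y)$ is the universal C*-algebra receiving morphisms from both $C(X)$ and $C(Y)$ which agree on the coordinates. **Spheres and cubes.** The free sphere $S^{N-1}_{\mathbb R,+}$ is given by $C(S^{N-1}_{\mathbb R,+})=C^*(x_1,\dots,x_N\mid x_i=x_i^*,\ \sum_i x_i^2=1)$. Let $S^{N-1}_{\mathbb R}$ be the usual sphere, $S^{N-1}_{\mathbb R,*}\subset S^{N-1}_{\mathbb R,+}$ the subspace given by $x_ix_jx_k=x_kx_jx_i$, and $S^{N-1}_{\mathbb R,\infty}\subset S^{N-1}_{\mathbb R,+}$ the subspace given by $x_i^2x_j=x_jx_i^2$. For a group $\Gamma=\langle g_1,\dots,g_N\rangle$ with $g_i^2=1$, the noncommutative cube $\widehat\Gamma$ is given by the full group C*-algebra $C(\widehat\Gamma)=C^*(\Gamma)$ with coordinates $x_i=g_i/\sqrt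 N$. The sphere $S^{N-1}_\Gamma\subset S^{N-1}_{\mathbb R,+}$ associated to $\Gamma$ is given by the relations $x_{i_1}\cdots x_{i_k}=x_{j_1}\cdots x_{j_k}$ for all $k$, all partitions $\pi$ of $k$ upper and $k$ lower points in which every block has as many upper as lower points and such that $g_{i_1}\cdots g_{i_k}=g_{j_1}\cdots g_{j_k}$ whenever the blocks of $\pi$ join equal indices of $\binom ij$, and all such multi-indices $i,j$. The basic groups are $\mathbb Z_2^N$, the free product $\mathbb Z_2^{*N}$, and its quotient $\mathbb Z_2^{\circ N}$ by the relations $abc=cba$ between the generators. **Quantum groups.** $O_N^+$ is given by the universal C*-algebra generated by the entries of an orthogonal $N\times N$ matrix $u$ (that is, $u_{ij}=u_{ij}^*$, $uu^t=u^tu=1$). A quantum group $G\subset O_N^+$ is a subspace such that there are morphisms $\Delta:C(G)\to C(G)\otimes C(G)$, $\varepsilon:C(G)\to\mathbb C$, $S:C(G)\to C(G)^{opp}$ with $\Delta(u_{ij})=\sum_k u_{ik}\otimes u_{kj}$, $\varepsilon(u_{ij})=\delta_{ij}$, $S(u_{ij})=u_{ji}$. It acts affinely on $X\subset S^{N-1}_{\mathbb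 R,+}$, written $G\curvearrowright X$, when there is a morphism $\Phi:C(X)\to C(G)\otimes C(X)$ with $\Phi(x_i)=\sum_j u_{ij}\otimes x_j$. Let $H_N=\mathbb Z_2\wr S_N$ be the group of signed permutation matrices. Let $H_N^{*}\subset O_N^+$ be given by the relations $ab=0$ for entries $a\ne b$ of $u$ on the same row or column, and $abc=cba$ for any entries $a,b,c$. Let $H_N^{[\infty]}\subset O_N^+$ be given by the relations $abc=0$ for entries $a\ne c$ on the same row or column and any entry $b$. The quantum isometry group of $X$ is $G^+(X)=\max\{G\subset O_N^+\mid G\curvearrowright X\}$, and the quantum reflection group of $X$ is $H^+(X)=\max\{G\subset H_N^{[\infty]}\mid G\curvearrowright X\}$. **Proposition 5.5.** The spheres associated to $\mathbb Z_2^N,\mathbb Z_2^{\circ N},\mathbb Z_2^{*N}$ are respectively $S^{N-1}_{\mathbb R},S^{N-1}_{\mathbb R,*},S^{N-1}_{\mathbb R,\infty}$, and there are inclusions $$\begin{matrix}S^{N-1}_{\mathbb R}&\subset&S^{N-1}_{\mathbb R,*}&\subset&S^{N-1}_{\mathbb R,\infty}\\ \cup&&\cup&&\cup\\ \widehat{\mathbb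 Z_2^N}&\subset&\widehat{\mathbb Z_2^{\circ N}}&\subset&\widehat{\mathbb Z_2^{*N}}\end{matrix}$$ The quantum reflection groups of these six spaces exist, satisfy $H^+(X)=G^+(X)\cap H_N^{[\infty]}$ for any quantum group $G^+(X)$ with the above maximality property, and are $$H^+(S^{N-1}_{\mathbb R})=H^+(\widehat{\mathbb Z_2^N})=H_N,\qquad H^+(S^{N-1}_{\mathbb R,*})=H^+(\widehat{\mathbb Z_2^{\circ N}})=H_N^*,\qquad H^+(S^{N-1}_{\mathbb R,\infty})=H^+(\widehat{\mathbb Z_2^{*N}})=H_N^{[\infty]},$$ with inclusions $H_N\subset H_N^*\subset H_N^{[\infty]}$. -/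

import Mathlib

open scoped TensorProduct ENNReal

noncomputable section

/-! ### Universal C*-algebras

Throughout, C*-algebras are unital and *-homomorphisms preserve the unit. -/

/-- A class of families of elements, indexed by `ι`, of C*-algebras. -/
abbrev FamilyClass (ι : Type) : Type 1 := ∀ (C : Type) [CStarAlgebra C], (ι → C) → Prop

/-- Evaluation at the family `f`, and at the adjoints of its members, of noncommutative
polynomials in variables `inl i` (standing for `f i`) and `inr i` (standing for `(f i)^*`). -/
def starEval {ι C : Type} [CStarAlgebra C] (f : ι → C) : FreeAlgebra ℂ (ι ⊕ ι) →ₐ[ℂ] C :=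
  FreeAlgebra.lift ℂ (Sum.elim f fun i => star (f i))

namespace UnivCStar

variable {ι : Type} (R : FamilyClass ι) (b : ι → ℝ)

/-- The C*-seminorms on noncommutative *-polynomials which come from a family of class `R`, in a
nonzero C*-algebra, whose `i`-th member has norm at most `b i`. They are the equivalence classes of
such families: two families with the same seminorm generate C*-algebras which are isomorphic by an
isomorphism matching the families. -/
def Index : Type :=
  {p : FreeAlgebra ℂ (ι ⊕ ι) → ℝ //
    ∃ (C : Type) (_ : CStarAlgebra C) (_ : Nontrivial C) (f : ι → C),
      R C f ∧ (∀ i, ‖f i‖ ≤ b i) ∧ ∀ a, p a = ‖starEval f a‖}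

variable {R b}

/-- The C*-algebra of a chosen representative of an equivalence class. -/
def Carrier (p : Index R b) : Type := p.2.choose

instance (p : Index R b) : CStarAlgebra (Carrier p) := p.2.choose_spec.choose

instance (p : Index R b) : Nontrivial (Carrier p) := p.2.choose_spec.choose_spec.choose

/-- The chosen representative of an equivalence class. -/
def family (p : Index R b) : ι → Carrier p := p.2.choose_spec.choose_spec.choose_spec.choose

theorem norm_family_le (p : Index R b) (i : ι) : ‖family p i‖ ≤ b i :=
  p.2.choose_spec.choose_spec.choose_spec.choose_spec.2.1 i

/-- The bounded sections form a C*-algebra. -/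
instance : CStarAlgebra (lp (fun p : Index R b => Carrier p) ∞) where

variable (R b)

/-- The direct sum of all the representatives. -/
def bigFamily (i : ι) : lp (fun p : Index R b => Carrier p) ∞ :=
  ⟨fun p => family p i, memℓp_infty ⟨b i, by rintro _ ⟨p, rfl⟩; exact norm_family_le p i⟩⟩

/-- The C*-algebra generated by the direct sum of all the representatives. -/
def closedSpan : StarSubalgebra ℂ (lp (fun p : Index R b => Carrier p) ∞) :=
  (StarAlgebra.adjoin ℂ (Set.range (bigFamily R b))).topologicalClosure

instance : IsClosed (closedSpan R b : Set (lp (fun p : Index R b => Carrier p) ∞)) :=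
  StarSubalgebra.isClosed_topologicalClosure _

theorem bigFamily_mem (i : ι) : bigFamily R b i ∈ closedSpan R b :=
  StarSubalgebra.le_topologicalClosure _ (StarAlgebra.subset_adjoin ℂ _ ⟨i, rfl⟩)

end UnivCStar

/-- The universal C*-algebra generated by a family of class `R` whose `i`-th member has norm at
most `b i`: the norm of a noncommutative *-polynomial in the generators is the supremum of its
norms over all such families. In every use below, the norm bound follows from membership in `R`. -/
def UnivCStar {ι : Type} (R : FamilyClass ι) (b : ι → ℝ) : Type := UnivCStar.closedSpan R b

namespace UnivCStar

variable {ι : Type} (R : FamilyClass ι) (b : ι → ℝ)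

instance : CStarAlgebra (UnivCStar R b) :=
  inferInstanceAs (CStarAlgebra (UnivCStar.closedSpan R b))

/-- The generators of the universal C*-algebra. -/
def gen (i : ι) : UnivCStar R b := ⟨bigFamily R b i, bigFamily_mem R b i⟩

end UnivCStar

/-! ### The spatial tensor product -/

/-- The families `(a ⊗ 1)_{a ∈ A}`, `(1 ⊗ b)_{b ∈ B}` coming from a pair of Hilbert space
representations `π`, `ρ` of `A`, `B`, namely `a ↦ π(a) ⊗ 1` and `b ↦ 1 ⊗ ρ(b)` on the Hilbert space
tensor product (the algebra `C` being embedded into the bounded operators on it). -/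
def SpatialClass (A B : Type) [CStarAlgebra A] [CStarAlgebra B] : FamilyClass (A ⊕ B) :=
  fun C _ f =>
    ∃ (H K : Type) (_ : NormedAddCommGroup H) (_ : InnerProductSpace ℂ H) (_ : CompleteSpace H)
      (_ : NormedAddCommGroup K) (_ : InnerProductSpace ℂ K) (_ : CompleteSpace K)
      (π : A →⋆ₐ[ℂ] (H →L[ℂ] H)) (ρ : B →⋆ₐ[ℂ] (K →L[ℂ] K))
      (j : C →⋆ₐ[ℂ] (UniformSpace.Completion (H ⊗[ℂ] K) →L[ℂ] UniformSpace.Completion (H ⊗[ℂ] K))),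
      Function.Injective j ∧
      (∀ a, j (f (Sum.inl a)) = (TensorProduct.mapL (π a) (ContinuousLinearMap.id ℂ K)).completion) ∧
      (∀ b, j (f (Sum.inr b)) = (TensorProduct.mapL (ContinuousLinearMap.id ℂ H) (ρ b)).completion)

/-- The spatial (minimal) tensor product of two C*-algebras. -/
abbrev CTensor (A B : Type) [CStarAlgebra A] [CStarAlgebra B] : Type :=
  UnivCStar (SpatialClass A B) (Sum.elim (fun a => ‖a‖) (fun b => ‖b‖))

/-- The elementary tensor `a ⊗ b`. -/
def ctmul {A B : Type} [CStarAlgebra A] [CStarAlgebra B] (a : A) (b : B) : CTensor A B :=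
  UnivCStar.gen _ _ (Sum.inl a) * UnivCStar.gen _ _ (Sum.inr b)

/-! ### Noncommutative spaces with coordinates -/

/-- A noncommutative compact space `X` with coordinates: the C*-algebra `C(X)`, together with
elements `x i ∈ C(X)`. -/
structure NCSpace (ι : Type) where
  /-- the algebra `C(X)` -/
  alg : Type
  /-- its C*-algebra structure -/
  [cstar : CStarAlgebra alg]
  /-- the coordinates -/
  coord : ι → alg

attribute [instance] NCSpace.cstar

namespace NCSpace

variable {ι : Type}

/-- `X ⊆ Y` as a closed subspace: a quotient map `C(Y) → C(X)` mapping coordinates to coordinates.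
(A *-homomorphism between C*-algebras has closed range, so dense range means surjective.) -/
def IsSubspace (X Y : NCSpace ι) : Prop :=
  ∃ φ : Y.alg →⋆ₐ[ℂ] X.alg, DenseRange φ ∧ ∀ i, φ (Y.coord i) = X.coord i

/-- `X = Y`: an isomorphism `C(X) ≃ C(Y)` mapping coordinates to coordinates. -/
def Same (X Y : NCSpace ι) : Prop :=
  ∃ φ : X.alg ≃⋆ₐ[ℂ] Y.alg, ∀ i, φ (X.coord i) = Y.coord i

/-- The space of all families of class `R` of contractions. -/
def univ (R : FamilyClass ι) : NCSpace ι where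
  alg := UnivCStar R fun _ => 1
  coord := UnivCStar.gen R fun _ => 1

/-- The intersection `X ∩ Y`: its algebra is the universal one receiving morphisms from both `C(X)`
and `C(Y)` which agree on the coordinates. -/
def inter (X Y : NCSpace ι) : NCSpace ι where
  alg := UnivCStar (fun C _ f => (∃ φ : X.alg →⋆ₐ[ℂ] C, ∀ i, φ (X.coord i) = f i) ∧
    ∃ ψ : Y.alg →⋆ₐ[ℂ] C, ∀ i, ψ (Y.coord i) = f i) fun i => ‖X.coord i‖
  coord := UnivCStar.gen _ _

end NCSpace

open NCSpace

/-! ### Spheres -/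

/-- The relations of the free sphere: `x_i = x_i^*` and `∑ x_i^2 = 1`. -/
def FreeSphereRel (N : ℕ) : FamilyClass (Fin N) := fun _ _ x =>
  (∀ i, IsSelfAdjoint (x i)) ∧ ∑ i, x i ^ 2 = 1

/-- The usual sphere `S^{N-1} ⊆ ℝ^N`, with its standard coordinates. -/
def realSphere (N : ℕ) : NCSpace (Fin N) where
  alg := C(Metric.sphere (0 : EuclideanSpace ℝ (Fin N)) 1, ℂ)
  coord i := ⟨fun x => ((x.1 i : ℝ) : ℂ), by fun_prop⟩

/-- The half-liberated sphere: the free sphere with `x_i x_j x_k = x_k x_j x_i`. -/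
def halfSphere (N : ℕ) : NCSpace (Fin N) := univ fun C _ x =>
  FreeSphereRel N C x ∧ ∀ i j k, x i * x j * x k = x k * x j * x i

/-- The sphere `S_{ℝ,∞}`: the free sphere with `x_i^2 x_j = x_j x_i^2`. -/
def inftySphere (N : ℕ) : NCSpace (Fin N) := univ fun C _ x =>
  FreeSphereRel N C x ∧ ∀ i j, x i ^ 2 * x j = x j * x i ^ 2

/-- The monomial `y_{i_1} ⋯ y_{i_k}`. -/
def wordProd {N k : ℕ} {M : Type} [Monoid M] (y : Fin N → M) (i : Fin k → Fin N) : M :=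
  (List.ofFn fun r => y (i r)).prod

/-- `kerPart i j ≤ π` in the sense of partitions, that is, the blocks of `π` join equal indices of
the multi-index with upper row `i` and lower row `j`. Partitions of `k` upper and `l` lower points
are equivalence relations on `Fin k ⊕ Fin l`. -/
def KerLE {N k l : ℕ} (i : Fin k → Fin N) (j : Fin l → Fin N) (π : Setoid (Fin k ⊕ Fin l)) : Prop :=
  ∀ s t, π s t → Sum.elim i j s = Sum.elim i j t

/-- Every block of `π` has as many upper legs as lower legs. -/
def IsVert {k : ℕ} (π : Setoid (Fin k ⊕ Fin k)) : Prop :=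
  ∀ s, {r : Fin k | π (Sum.inl r) s}.ncard = {r : Fin k | π (Sum.inr r) s}.ncard

section

variable {N : ℕ} {Γ : Type} [Group Γ] (g : Fin N → Γ)

/-- The partitions associated to a group `Γ = ⟨g_1, …, g_N⟩`. -/
def IsGroupPartition {k l : ℕ} (π : Setoid (Fin k ⊕ Fin l)) : Prop :=
  ∀ (i : Fin k → Fin N) (j : Fin l → Fin N), KerLE i j π → wordProd g i = wordProd g j

/-- The monomial sphere associated to `Γ = ⟨g_1, …, g_N⟩`: the free sphere with the relations
`x_{i_1} ⋯ x_{i_k} = x_{j_1} ⋯ x_{j_k}` for all `i, j` with `ker (i, j) ≤ π`, where `π` is any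
partition associated to `Γ` whose blocks have as many upper legs as lower legs. -/
def groupSphere : NCSpace (Fin N) := univ fun C _ x =>
  FreeSphereRel N C x ∧ ∀ (k : ℕ) (π : Setoid (Fin k ⊕ Fin k)), IsVert π → IsGroupPartition g π →
    ∀ i j : Fin k → Fin N, KerLE i j π → wordProd x i = wordProd x j

/-! ### Cubes -/

/-- The full group C*-algebra `C*(Γ)`, universal for the unitary representations of `Γ`. -/
abbrev GroupCStar (Γ : Type) [Group Γ] : Type :=
  UnivCStar (ι := Γ) (fun C _ f => ∃ φ : Γ →* unitary C, ∀ γ, f γ = φ γ) fun _ => 1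

/-- The noncommutative cube: the dual of `Γ = ⟨g_1, …, g_N⟩`, with coordinates `g_i / √N`. -/
def cube : NCSpace (Fin N) where
  alg := GroupCStar Γ
  coord i := ((Real.sqrt N : ℝ) : ℂ)⁻¹ • UnivCStar.gen _ _ (g i)

end

/-- The cyclic group of order two, written multiplicatively. -/
abbrev Z2 : Type := Multiplicative (ZMod 2)

/-- The generator of the cyclic group of order two. -/
def z2gen : Z2 := Multiplicative.ofAdd 1

/-- The generators of `ℤ_2^N`. -/
def powGen (N : ℕ) (i : Fin N) : Fin N → Z2 := Pi.mulSingle i z2gen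

/-- The free product `ℤ_2^{*N}`. -/
abbrev FreeRefl (N : ℕ) : Type := Monoid.CoprodI fun _ : Fin N => Z2

/-- The generators of `ℤ_2^{*N}`. -/
def freeGen (N : ℕ) (i : Fin N) : FreeRefl N := Monoid.CoprodI.of (i := i) z2gen

/-- The group `ℤ_2^{∘N}`: the quotient of `ℤ_2^{*N}` by the relations `abc = cba` between the
generators. -/
abbrev HalfRefl (N : ℕ) : Type :=
  FreeRefl N ⧸ Subgroup.normalClosure {w : FreeRefl N | ∃ i j k,
    w = freeGen N i * freeGen N j * freeGen N k * (freeGen N k * freeGen N j * freeGen N i)⁻¹}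

/-- The generators of `ℤ_2^{∘N}`. -/
def halfGen (N : ℕ) (i : Fin N) : HalfRefl N := QuotientGroup.mk (freeGen N i)

/-! ### Quantum groups -/

/-- The relations of `O_N^+`: the matrix `u` is orthogonal, `u = ū` and `u^t = u^{-1}`. -/
def OrthRel (N : ℕ) : FamilyClass (Fin N × Fin N) := fun _ _ u =>
  (∀ p, IsSelfAdjoint (u p)) ∧
  (∀ i j, ∑ k, u (i, k) * u (j, k) = if i = j then 1 else 0) ∧
  (∀ i j, ∑ k, u (k, i) * u (k, j) = if i = j then 1 else 0)

/-- Two distinct positions on the same row or column of a matrix. -/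
def Aligned {N : ℕ} (p q : Fin N × Fin N) : Prop := p ≠ q ∧ (p.1 = q.1 ∨ p.2 = q.2)

/-- Wang's free orthogonal quantum group `O_N^+`. -/
def OPlus (N : ℕ) : NCSpace (Fin N × Fin N) := univ (OrthRel N)

/-- The hyperoctahedral group `H_N = ℤ_2 ≀ S_N`, with its coordinates as a group of signed
permutation matrices: `(ε, σ)` is the matrix mapping `e_j` to `ε_{σ(j)} e_{σ(j)}`. -/
def HClassical (N : ℕ) : NCSpace (Fin N × Fin N) where
  alg := ((Fin N → ℤˣ) × Equiv.Perm (Fin N)) → ℂ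
  coord p := fun h => if p.1 = h.2 p.2 then (((h.1 p.1 : ℤˣ) : ℤ) : ℂ) else 0

/-- The quantum group `H_N^*`: the relations are those of the free hyperoctahedral quantum group
`H_N^+`, namely orthogonality and `ab = 0` for `a ≠ b` on the same row or column, together with
`abc = cba`. -/
def HStar (N : ℕ) : NCSpace (Fin N × Fin N) := univ fun C _ u =>
  OrthRel N C u ∧ (∀ p q, Aligned p q → u p * u q = 0) ∧
    ∀ p q r, u p * u q * u r = u r * u q * u p

/-- The quantum group `H_N^{[∞]}`: orthogonality and `abc = 0` for `a ≠ c` on the same row or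
column. -/
def HInfty (N : ℕ) : NCSpace (Fin N × Fin N) := univ fun C _ u =>
  OrthRel N C u ∧ ∀ p q r, Aligned p r → u p * u q * u r = 0

section

variable {N : ℕ}

/-- `G ⊆ O_N^+` is a quantum group: it is a closed subspace of `O_N^+`, and there are a
comultiplication, a counit and an antipode on `C(G)`, given by the formulae of `O_N^+`. -/
structure IsQuantumGroup (G : NCSpace (Fin N × Fin N)) : Prop where
  subspace : IsSubspace G (OPlus N)
  comul : ∃ Δ : G.alg →⋆ₐ[ℂ] CTensor G.alg G.alg,
    ∀ i j, Δ (G.coord (i, j)) = ∑ k, ctmul (G.coord (i, k)) (G.coord (k, j))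
  counit : ∃ ε : G.alg →⋆ₐ[ℂ] ℂ, ∀ i j, ε (G.coord (i, j)) = if i = j then 1 else 0
  antipode : ∃ S : G.alg →⋆ₐ[ℂ] (G.alg)ᵐᵒᵖ,
    ∀ i j, S (G.coord (i, j)) = MulOpposite.op (G.coord (j, i))

/-- `G` acts affinely on `X`, by `x_i ↦ ∑_j u_ij ⊗ x_j`. (Such a morphism is automatically
coassociative and counital, since it is so on the coordinates.) -/
def ActsOn (G : NCSpace (Fin N × Fin N)) (X : NCSpace (Fin N)) : Prop :=
  ∃ Φ : X.alg →⋆ₐ[ℂ] CTensor G.alg X.alg,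
    ∀ i, Φ (X.coord i) = ∑ j, ctmul (G.coord (i, j)) (X.coord j)

/-- `G` is the largest quantum group contained in `M` and acting affinely on `X`. -/
structure IsLargestActing (M : NCSpace (Fin N × Fin N)) (X : NCSpace (Fin N))
    (G : NCSpace (Fin N × Fin N)) : Prop where
  isQuantumGroup : IsQuantumGroup G
  subspace : IsSubspace G M
  acts : ActsOn G X
  largest : ∀ K : NCSpace (Fin N × Fin N),
    IsQuantumGroup K → IsSubspace K M → ActsOn K X → IsSubspace K G

/-- `G = G^+(X)`, the quantum (affine) isometry group of `X`. -/
def IsQuantumIsometryGroup (X : NCSpace (Fin N)) (G : NCSpace (Fin N × Fin N)) : Prop :=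
  IsLargestActing (OPlus N) X G

/-- `G = H^+(X)`, the quantum reflection group of `X`: the largest quantum group acting affinely on
`X` and contained in `H_N^{[∞]}`, which is also the intersection of `H_N^{[∞]}` with the quantum
isometry group of `X`. -/
def IsQuantumReflectionGroup (X : NCSpace (Fin N)) (G : NCSpace (Fin N × Fin N)) : Prop :=
  IsLargestActing (HInfty N) X G ∧
    ∀ K, IsQuantumIsometryGroup X K → Same (inter K (HInfty N)) G

end

end

/-! Every space here is presented by relations, so an inclusion, a structure map or an action exists
once the proposed images of the coordinates satisfy the relations (the `exists_lift` lemmas).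

Spheres. A partition with balanced blocks only equates words that are permutations of each other
(`perm_of_isVert`), so each relation of the sphere of a group is between permuted words that agree
in the group. In the free product, agreement means equal reduced words, and centrality of squares
pulls out the cancelled pairs (`exists_squares`). In `ℤ_2^{∘N}`, agreement fixes, for each letter,
its excess at odd over even positions; together with the total count this fixes both multiplicities,
and half-commutation permutes odd and even positions separately (`prod_eq_of_splitWord_perm`).
Conversely, one small partition per group produces the defining relation of the sphere.

Quantum groups. The relations of `H_N^{[∞]}` make products of aligned entries vanish and each
`u_p^2` a central projection (`InftyRel.mul_eq_zero`, `InftyRel.sq_commute`, `InftyRel.cube_eq`).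
This makes it act on the free cube and on `S_{ℝ,∞}`, where its maximality is immediate. For the
other four spaces, an action of `K ⊆ H_N^{[∞]}` is restricted to the cube inside `X`: the elements
`∑_j u_ij ⊗ g_j/√N` must commute, or half-commute. Comparing coefficients of the group element `g_a
g_b`, or `g_a g_b g_c`, and multiplying by the central projection `u_ia^2` leaves exactly the
commutation, or half-commutation, of the entries (`InftyRel.classRel_of_tact`,
`InftyRel.starRel_of_tact`). Coefficients are extracted by slice maps along permutation
representations.

The description as `G^+(X) ∩ H_N^{[∞]}` is formal: intersections of quantum groups are quantum
groups, and actions restrict. -/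

noncomputable section

/-! ### Extension of morphisms from generators -/

section Generators

variable {ι A C D : Type} [CStarAlgebra A] [CStarAlgebra C] [CStarAlgebra D]

@[simp]
theorem starEval_inl (f : ι → C) (i : ι) : starEval f (FreeAlgebra.ι ℂ (Sum.inl i)) = f i := by
  simp [starEval]

@[simp]
theorem starEval_inr (f : ι → C) (i : ι) :
    starEval f (FreeAlgebra.ι ℂ (Sum.inr i)) = star (f i) := by
  simp [starEval]

theorem map_starEval (φ : C →⋆ₐ[ℂ] D) (f : ι → C) (P : FreeAlgebra ℂ (ι ⊕ ι)) :
    φ (starEval f P) = starEval (fun i => φ (f i)) P := by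
  induction P using FreeAlgebra.induction with
  | grade0 r => simp [AlgHomClass.commutes]
  | grade1 x => rcases x with i | i <;> simp [map_star]
  | mul a b ha hb => simp [ha, hb]
  | add a b ha hb => simp [ha, hb]

theorem starAlgHom_continuous (φ : C →⋆ₐ[ℂ] D) : Continuous φ :=
  AddMonoidHomClass.continuous_of_bound φ 1 fun a => by
    simpa using NonUnitalStarAlgHom.norm_apply_le φ a

/-- The variables come in pairs `inl i`, `inr i`, evaluated at `f i` and its adjoint, so the set of
values of polynomials is already closed under the involution. -/
theorem adjoin_le_range_starEval (f : ι → C) {a : C}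
    (ha : a ∈ StarAlgebra.adjoin ℂ (Set.range f)) : a ∈ Set.range (starEval f) := by
  induction ha using StarAlgebra.adjoin_induction with
  | mem x hx => obtain ⟨i, rfl⟩ := hx; exact ⟨_, starEval_inl f i⟩
  | algebraMap r => exact ⟨algebraMap ℂ _ r, by simp⟩
  | add x y _ _ hx hy => obtain ⟨P, rfl⟩ := hx; obtain ⟨Q, rfl⟩ := hy; exact ⟨P + Q, by simp⟩
  | mul x y _ _ hx hy => obtain ⟨P, rfl⟩ := hx; obtain ⟨Q, rfl⟩ := hy; exact ⟨P * Q, by simp⟩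
  | star x _ hx =>
    obtain ⟨P, rfl⟩ := hx
    clear * -
    induction P using FreeAlgebra.induction with
    | grade0 r => exact ⟨algebraMap ℂ _ (star r), by simpa using algebraMap_star_comm r⟩
    | grade1 x =>
      rcases x with i | i
      · exact ⟨_, by rw [starEval_inr, starEval_inl]⟩
      · exact ⟨FreeAlgebra.ι ℂ (Sum.inl i), by rw [starEval_inr, star_star, starEval_inl]⟩
    | mul a b ha hb =>
      obtain ⟨P, hP⟩ := ha; obtain ⟨Q, hQ⟩ := hb; exact ⟨Q * P, by simp [hP, hQ]⟩
    | add a b ha hb =>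
      obtain ⟨P, hP⟩ := ha; obtain ⟨Q, hQ⟩ := hb; exact ⟨P + Q, by simp [hP, hQ]⟩

theorem starEval_mem {S : StarSubalgebra ℂ C} {f : ι → C} (hf : ∀ i, f i ∈ S)
    (P : FreeAlgebra ℂ (ι ⊕ ι)) : starEval f P ∈ S := by
  induction P using FreeAlgebra.induction with
  | grade0 r => simp
  | grade1 x =>
    rcases x with i | i
    · simpa using hf i
    · simpa using star_mem (hf i)
  | mul a b ha hb => simpa using mul_mem ha hb
  | add a b ha hb => simpa using add_mem ha hb

/-- The family `f` generates `C` as a C*-algebra. -/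
def Generates (f : ι → C) : Prop := DenseRange (starEval f)

theorem generates_of_adjoin {f : ι → C}
    (h : (StarAlgebra.adjoin ℂ (Set.range f)).topologicalClosure = ⊤) : Generates f := by
  intro a
  have ha : a ∈ (StarAlgebra.adjoin ℂ (Set.range f)).topologicalClosure := by rw [h]; trivial
  rw [← SetLike.mem_coe, StarSubalgebra.topologicalClosure_coe] at ha
  exact closure_mono (fun x hx => adjoin_le_range_starEval f hx) ha

theorem Generates.map {f : ι → C} (hf : Generates f) (φ : C →⋆ₐ[ℂ] D) (hφ : DenseRange φ) :
    Generates fun i => φ (f i) := by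
  have h := hφ.comp hf (starAlgHom_continuous φ)
  refine h.mono ?_
  rintro _ ⟨P, rfl⟩
  exact ⟨P, (map_starEval φ f P).symm⟩

theorem Generates.hom_ext {f : ι → C} (hf : Generates f) {φ ψ : C →⋆ₐ[ℂ] D}
    (h : ∀ i, φ (f i) = ψ (f i)) : φ = ψ := by
  have := hf.equalizer (starAlgHom_continuous φ) (starAlgHom_continuous ψ)
    (by ext P; simp [map_starEval, h])
  exact DFunLike.coe_injective this

theorem Generates.mem {f : ι → C} (hf : Generates f) {S : StarSubalgebra ℂ C}
    (hS : IsClosed (S : Set C)) (h : ∀ i, f i ∈ S) (a : C) : a ∈ S :=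
  hf.induction (P := fun x => x ∈ S) (by rintro _ ⟨P, rfl⟩; exact starEval_mem h P) hS a

/-- A family which is dominated by a generating family is the image of it by a morphism. -/
theorem Generates.exists_hom {c : ι → A} (hc : Generates c) {f : ι → C}
    (h : ∀ P, ‖starEval f P‖ ≤ ‖starEval c P‖) : ∃ φ : A →⋆ₐ[ℂ] C, ∀ i, φ (c i) = f i := by
  -- The assignment `starEval c P ↦ starEval f P` is well defined and contractive by the norm
  -- domination, so it extends from a dense subspace; algebraic identities then pass to the closure.
  let F := (starEval f).toLinearMap.extendOfNorm (starEval c).toLinearMap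
  have hF (P) : F (starEval c P) = starEval f P :=
    LinearMap.extendOfNorm_eq (f := (starEval f).toLinearMap) (e := (starEval c).toLinearMap) hc
      ⟨1, by simpa using h⟩ P
  have hmul (a b : A) : F (a * b) = F a * F b := by
    refine hc.induction_on₂ (p := fun a b => F (a * b) = F a * F b) ?_ ?_ a b
    · exact isClosed_eq (by fun_prop) (by fun_prop)
    · intro P Q; rw [← map_mul, hF, hF, hF, map_mul]
  have hone : F 1 = 1 := by rw [← map_one (starEval c), hF, map_one]
  have hstar (a : A) : F (star a) = star (F a) := by
    refine hc.induction_on (p := fun a => F (star a) = star (F a)) a ?_ ?_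
    · exact isClosed_eq (by fun_prop) (by fun_prop)
    · intro P
      induction P using FreeAlgebra.induction with
      | grade0 r =>
        rw [hF]
        simp only [AlgHom.commutes, ← algebraMap_star_comm]
        rw [← AlgHom.commutes (starEval c), hF, AlgHom.commutes]
      | grade1 x =>
        rcases x with i | i
        · rw [hF, starEval_inl, starEval_inl, ← starEval_inr c, hF, starEval_inr]
        · rw [hF, starEval_inr, starEval_inr, star_star, star_star, ← starEval_inl c, hF,
            starEval_inl]
      | mul a b ha hb => rw [map_mul, star_mul, hmul, ha, hb, hmul, star_mul]
      | add a b ha hb => rw [map_add, star_add, map_add, ha, hb, map_add, star_add]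
  refine ⟨{ toFun := F, map_one' := hone, map_mul' := hmul, map_zero' := map_zero F,
            map_add' := map_add F, commutes' := fun r => ?_, map_star' := hstar }, fun i => ?_⟩
  · rw [Algebra.algebraMap_eq_smul_one, map_smul, hone, Algebra.algebraMap_eq_smul_one]
  · change F (c i) = f i
    rw [← starEval_inl c, hF, starEval_inl]

end Generators

/-! ### Universal property of the universal C*-algebra. -/

namespace UnivCStar

variable {ι : Type} {R : FamilyClass ι} {b : ι → ℝ}

/-- Evaluation of the universal C*-algebra at a representative. -/
def ev (p : Index R b) : UnivCStar R b →⋆ₐ[ℂ] Carrier p where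
  toFun a := (a.1 : ∀ p : Index R b, Carrier p) p
  map_one' := rfl
  map_mul' _ _ := rfl
  map_zero' := rfl
  map_add' _ _ := rfl
  commutes' _ := rfl
  map_star' _ := rfl

@[simp]
theorem ev_gen (p : Index R b) (i : ι) : ev p (gen R b i) = family p i := rfl

theorem family_mem (p : Index R b) : R (Carrier p) (family p) :=
  p.2.choose_spec.choose_spec.choose_spec.choose_spec.1

theorem norm_starEval_family (p : Index R b) (P) : ‖starEval (family p) P‖ = p.1 P :=
  (p.2.choose_spec.choose_spec.choose_spec.choose_spec.2.2 P).symm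

theorem ext_ev {x y : UnivCStar R b} (h : ∀ p, ev p x = ev p y) : x = y :=
  Subtype.ext (lp.ext (funext h))

theorem norm_le_of_ev {x : UnivCStar R b} {M : ℝ} (hM : 0 ≤ M) (h : ∀ p, ‖ev p x‖ ≤ M) : ‖x‖ ≤ M :=
  lp.norm_le_of_forall_le hM h

/-- The closure is taken in the ambient algebra of bounded sections; it pulls back to the subalgebra
because the inclusion is inducing. -/
theorem generates_gen : Generates (gen R b) := by
  intro a
  have ha : a.1 ∈ closure (Set.range (starEval (bigFamily R b))) :=
    closure_mono (fun x hx => adjoin_le_range_starEval (bigFamily R b) hx) a.2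
  let inc : UnivCStar R b →⋆ₐ[ℂ] lp (fun p : Index R b => Carrier p) ∞ := (closedSpan R b).subtype
  have hinc : Topology.IsInducing inc := Topology.IsInducing.subtypeVal
  have himage : inc '' Set.range (starEval (gen R b)) = Set.range (starEval (bigFamily R b)) := by
    ext x
    constructor
    · rintro ⟨_, ⟨P, rfl⟩, rfl⟩
      exact ⟨P, (map_starEval inc (gen R b) P).symm⟩
    · rintro ⟨P, rfl⟩
      exact ⟨_, ⟨P, rfl⟩, map_starEval inc (gen R b) P⟩
  rw [hinc.closure_eq_preimage_closure_image, himage]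
  exact ha

/-- The seminorm of `f` is one of the indices. The chosen representative there may differ from `f`,
but it has the same polynomial norms, and evaluation at an index is contractive. The zero algebra is
not indexed, hence the case split. -/
theorem norm_starEval_le {C : Type} [CStarAlgebra C] {f : ι → C} (hR : R C f)
    (hb : ∀ i, ‖f i‖ ≤ b i) (P : FreeAlgebra ℂ (ι ⊕ ι)) :
    ‖starEval f P‖ ≤ ‖starEval (gen R b) P‖ := by
  rcases subsingleton_or_nontrivial C with h | h
  · rw [Subsingleton.elim (starEval f P) 0, norm_zero]; positivity
  · let p : Index R b := ⟨fun P => ‖starEval f P‖, C, _, h, f, hR, hb, fun _ => rfl⟩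
    have h1 := norm_starEval_family p P
    have h2 := NonUnitalStarAlgHom.norm_apply_le (ev p) (starEval (gen R b) P)
    rw [map_starEval] at h2
    simp only [ev_gen] at h2
    exact h1.symm.le.trans h2

/-- The universal property. -/
theorem exists_lift {C : Type} [CStarAlgebra C] {f : ι → C} (hR : R C f)
    (hb : ∀ i, ‖f i‖ ≤ b i) : ∃ φ : UnivCStar R b →⋆ₐ[ℂ] C, ∀ i, φ (gen R b i) = f i :=
  generates_gen.exists_hom (norm_starEval_le hR hb)

/-- A morphism into a universal C*-algebra, from its components. -/
theorem exists_hom_of_forall_ev {κ A : Type} [CStarAlgebra A] {c : κ → A} (hc : Generates c)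
    {f : κ → UnivCStar R b}
    (h : ∀ p : Index R b, ∃ φ : A →⋆ₐ[ℂ] Carrier p, ∀ i, φ (c i) = ev p (f i)) :
    ∃ φ : A →⋆ₐ[ℂ] UnivCStar R b, ∀ i, φ (c i) = f i := by
  refine hc.exists_hom fun P => norm_le_of_ev (norm_nonneg _) fun p => ?_
  obtain ⟨φ, hφ⟩ := h p
  rw [map_starEval, ← funext hφ, ← map_starEval]
  exact NonUnitalStarAlgHom.norm_apply_le φ _

end UnivCStar

/-! ### Representations -/

section States

variable {A : Type} [CStarAlgebra A]

open scoped ComplexOrder in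
/-- A norm one functional with value one at the unit is positive. -/
theorem apply_nonneg_of_norm_le_one [PartialOrder A] [StarOrderedRing A] (f : A →L[ℂ] ℂ)
    (hf : ‖f‖ ≤ 1) (h1 : f 1 = 1) {a : A} (ha : 0 ≤ a) : 0 ≤ f a := by
  have hsa : IsSelfAdjoint a := ha.isSelfAdjoint
  have hb (x : A) : ‖f x‖ ≤ ‖x‖ := (f.le_opNorm x).trans (mul_le_of_le_one_left (norm_nonneg _) hf)
  have : Nontrivial A := ⟨1, 0, fun h => by simp [h] at h1⟩
  have him : (f a).im = 0 := by
    -- Compare `|f(a + it)|^2` with `‖a + it‖^2 ≤ ‖a‖^2 + t^2`: the terms in `t^2` cancel, leaving a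
    -- bound on a function linear in `t`.
    by_contra hne
    have key (t : ℝ) : 2 * (f a).im * t ≤ ‖a‖ ^ 2 := by
      have e1 : ‖a + algebraMap ℂ A (Complex.I * t)‖ ^ 2 ≤ ‖a‖ ^ 2 + t ^ 2 := by
        have e3 : star (a + algebraMap ℂ A (Complex.I * t)) * (a + algebraMap ℂ A (Complex.I * t))
            = a * a + algebraMap ℂ A ((t : ℂ) ^ 2) := by
          rw [star_add, hsa.star_eq, ← algebraMap_star_comm]
          have : star (Complex.I * (t : ℂ)) = -(Complex.I * t) := by
            simp [Complex.conj_ofReal]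
          rw [this, map_neg, add_mul, mul_add, mul_add, neg_mul, neg_mul,
            (Algebra.commutes (Complex.I * (t : ℂ)) a).symm, ← map_mul]
          have h2 : (Complex.I * (t : ℂ)) * (Complex.I * t) = -(t : ℂ) ^ 2 := by
            linear_combination (t : ℂ) ^ 2 * Complex.I_sq
          rw [h2, map_neg]
          abel
        calc _ = ‖a * a + algebraMap ℂ A ((t : ℂ) ^ 2)‖ := by
              rw [← e3, CStarRing.norm_star_mul_self, sq]
          _ ≤ ‖a * a‖ + ‖algebraMap ℂ A ((t : ℂ) ^ 2)‖ := norm_add_le _ _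
          _ ≤ ‖a‖ ^ 2 + t ^ 2 := by
              gcongr
              · rw [sq]; exact norm_mul_le _ _
              · rw [norm_algebraMap']; simp
      have e2 := hb (a + algebraMap ℂ A (Complex.I * t))
      rw [map_add, Algebra.algebraMap_eq_smul_one, map_smul, h1, smul_eq_mul, mul_one,
        ← Algebra.algebraMap_eq_smul_one] at e2
      have e4 : ‖f a + Complex.I * t‖ ^ 2 = (f a).re ^ 2 + ((f a).im + t) ^ 2 := by
        rw [Complex.sq_norm, Complex.normSq_apply]; simp; ring
      have e5 := pow_le_pow_left₀ (norm_nonneg _) e2 2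
      nlinarith [sq_nonneg (f a).re, sq_nonneg (f a).im]
    -- This `t` turns the left side of `key` into `‖a‖ ^ 2 + 1`.
    have := key ((‖a‖ ^ 2 + 1) / (2 * (f a).im))
    rw [mul_div_cancel₀ _ (by simpa using hne)] at this
    linarith
  -- From `0 ≤ ‖a‖ - a ≤ ‖a‖`. Applying `f` gives `‖a‖ - Re f(a) ≤ ‖a‖`, which is positivity.
  have hle : ‖algebraMap ℂ A ‖a‖ - a‖ ≤ ‖a‖ := by
    have e0 : algebraMap ℂ A ‖a‖ = algebraMap ℝ A ‖a‖ := by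
      rw [IsScalarTower.algebraMap_apply ℝ ℂ A]; rfl
    rw [e0]
    have h2 : a ≤ algebraMap ℝ A ‖a‖ := IsSelfAdjoint.le_algebraMap_norm_self
    calc _ ≤ ‖algebraMap ℝ A ‖a‖‖ :=
          CStarAlgebra.norm_le_norm_of_nonneg_of_le (sub_nonneg.2 h2) (by simpa using ha)
      _ = ‖a‖ := by rw [norm_algebraMap']; simp
  have h3 := (hb _).trans hle
  rw [map_sub, Algebra.algebraMap_eq_smul_one, map_smul, h1, smul_eq_mul, mul_one] at h3
  have h4 := (Complex.abs_re_le_norm _).trans h3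
  rw [Complex.sub_re, Complex.ofReal_re] at h4
  rw [Complex.nonneg_iff]
  exact ⟨by linarith [(abs_le.1 h4).2], him.symm⟩

open scoped ComplexOrder in
-- By Gelfand duality a character of the commutative C*-algebra generated by `a` does not vanish at
-- `a`. Its Hahn–Banach extension keeps norm at most one and value one at the unit, so it is
-- positive.
theorem exists_positive_ne_zero [PartialOrder A] [StarOrderedRing A] {a : A} (hsa : IsSelfAdjoint a)
    (ha : a ≠ 0) : ∃ f : A →ₚ[ℂ] ℂ, f a ≠ 0 := by
  have := hsa.isStarNormal
  let E := StarAlgebra.elemental ℂ a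
  let a' : E := ⟨a, StarAlgebra.elemental.self_mem ℂ a⟩
  have ha' : a' ≠ 0 := fun h => ha (congrArg Subtype.val h)
  obtain ⟨χ, hχ⟩ : ∃ χ : WeakDual.characterSpace ℂ E, χ a' ≠ 0 := by
    by_contra! h
    refine ha' ((gelfandTransform_bijective E).1 ?_)
    ext χ
    simpa using h χ
  have : Nontrivial E := ⟨a', 0, ha'⟩
  let χ' : E →L[ℂ] ℂ := WeakDual.toStrongDual χ.1
  obtain ⟨f, hf, hn⟩ := exists_extension_norm_eq (𝕜 := ℂ) E.toSubalgebra.toSubmodule χ'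
  have hχn : ‖χ'‖ ≤ 1 := by
    refine χ'.opNorm_le_bound zero_le_one fun x => ?_
    rw [one_mul]
    exact AlgHom.norm_apply_le_self (WeakDual.CharacterSpace.toAlgHom χ) x
  have h1 : f 1 = 1 := (hf (1 : E)).trans (map_one χ)
  refine ⟨PositiveLinearMap.mk₀ f.toLinearMap fun x hx =>
    apply_nonneg_of_norm_le_one f (hn.trans_le hχn) h1 hx, ?_⟩
  change f a ≠ 0
  rw [show f a = χ' a' from hf a']
  exact hχ

/-- The Hilbert space representations of a C*-algebra separate its points. -/
theorem exists_rep_ne_zero {a : A} (ha : a ≠ 0) :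
    ∃ (H : Type) (_ : NormedAddCommGroup H) (_ : InnerProductSpace ℂ H) (_ : CompleteSpace H)
      (π : A →⋆ₐ[ℂ] (H →L[ℂ] H)) (ξ : H), π a ξ ≠ 0 := by
  let _ := CStarAlgebra.spectralOrder A
  have := CStarAlgebra.spectralOrderedRing A
  have hne : star a * a ≠ 0 := by simpa [CStarRing.star_mul_self_eq_zero_iff] using ha
  obtain ⟨f, hf⟩ := exists_positive_ne_zero (IsSelfAdjoint.star_mul_self a) hne
  -- In the GNS representation of `f` the class `ξ` of the unit satisfies `‖π(a) ξ‖^2 = f(a^* a)`.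
  refine ⟨f.GNS, inferInstance, inferInstance, inferInstance, f.gnsStarAlgHom,
    ((f.toPreGNS 1 : f.PreGNS) : f.GNS), fun h0 => hf ?_⟩
  have h1 : ((f.toPreGNS a : f.PreGNS) : f.GNS) = 0 := by
    rw [← h0]
    change _ = f.gnsNonUnitalStarAlgHom a _
    rw [PositiveLinearMap.gnsNonUnitalStarAlgHom_apply_coe]
    simp
  have h2 := UniformSpace.Completion.inner_coe (𝕜 := ℂ) (f.toPreGNS a) (f.toPreGNS a)
  rw [h1, inner_zero_left, PositiveLinearMap.preGNS_inner_def] at h2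
  simpa using h2.symm

end States

/-! ### The spatial tensor product -/

section Amplification

open UniformSpace

variable {H K : Type} [NormedAddCommGroup H] [InnerProductSpace ℂ H]
  [NormedAddCommGroup K] [InnerProductSpace ℂ K]

theorem completion_id' {E : Type} [NormedAddCommGroup E] [InnerProductSpace ℂ E] :
    (ContinuousLinearMap.id ℂ E).completion = 1 := by
  ext x
  induction x using Completion.induction_on with
  | hp => apply isClosed_eq <;> fun_prop
  | ih x => simp

theorem completion_add' {E : Type} [NormedAddCommGroup E] [InnerProductSpace ℂ E]
    (S T : E →L[ℂ] E) : (S + T).completion = S.completion + T.completion := by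
  ext x
  induction x using Completion.induction_on with
  | hp => apply isClosed_eq <;> fun_prop
  | ih x => simp [Completion.coe_add]

theorem completion_smul' {E : Type} [NormedAddCommGroup E] [InnerProductSpace ℂ E]
    (r : ℂ) (S : E →L[ℂ] E) : (r • S).completion = r • S.completion := by
  ext x
  induction x using Completion.induction_on with
  | hp => exact isClosed_eq (ContinuousLinearMap.continuous _) (ContinuousLinearMap.continuous _)
  | ih x =>
    rw [smul_apply, ContinuousLinearMap.completion_apply_coe,
      ContinuousLinearMap.completion_apply_coe, smul_apply,
      Completion.coe_smul]

theorem completion_mapL_mul (S S' : H →L[ℂ] H) (T T' : K →L[ℂ] K) :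
    (TensorProduct.mapL (S * S') (T * T')).completion =
      (TensorProduct.mapL S T).completion * (TensorProduct.mapL S' T').completion := by
  ext x
  induction x using Completion.induction_on with
  | hp => apply isClosed_eq <;> fun_prop
  | ih x =>
    rw [mul_apply_eq_comp]
    simp only [ContinuousLinearMap.completion_apply_coe]
    rw [TensorProduct.mapL_mul, mul_apply_eq_comp]

theorem completion_mapL_one :
    (TensorProduct.mapL (1 : H →L[ℂ] H) (1 : K →L[ℂ] K)).completion = 1 := by
  rw [ContinuousLinearMap.one_def, ContinuousLinearMap.one_def, TensorProduct.mapL_id_id,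
    completion_id']

variable [CompleteSpace H] [CompleteSpace K]

/-- Checked on elementary tensors, where the inner product factors. This identifies the adjoint of
`S ⊗ T` before completion. -/
theorem inner_mapL_left (S : H →L[ℂ] H) (T : K →L[ℂ] K) (x y : H ⊗[ℂ] K) :
    inner ℂ (TensorProduct.mapL (star S) (star T) x) y =
      inner ℂ x (TensorProduct.mapL S T y) := by
  induction x with
  | zero => simp
  | add x x' hx hx' => rw [map_add, inner_add_left, inner_add_left, hx, hx']
  | tmul h k =>
    induction y with
    | zero => simp
    | add y y' hy hy' => rw [map_add, inner_add_right, inner_add_right, hy, hy']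
    | tmul h' k' =>
      rw [TensorProduct.mapL_tmul, TensorProduct.mapL_tmul, TensorProduct.inner_tmul,
        TensorProduct.inner_tmul, ContinuousLinearMap.star_eq_adjoint,
        ContinuousLinearMap.star_eq_adjoint, ContinuousLinearMap.adjoint_inner_left,
        ContinuousLinearMap.adjoint_inner_left]

theorem completion_mapL_star (S : H →L[ℂ] H) (T : K →L[ℂ] K) :
    (TensorProduct.mapL (star S) (star T)).completion =
      star (TensorProduct.mapL S T).completion := by
  refine (ContinuousLinearMap.eq_adjoint_iff _ _).2 ?_
  intro x y
  induction x, y using Completion.induction_on₂ with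
  | hp => apply isClosed_eq <;> fun_prop
  | ih x y => simp only [ContinuousLinearMap.completion_apply_coe, Completion.inner_coe,
      inner_mapL_left]

variable (H K)

/-- The amplification `S ↦ S ⊗ 1`. -/
def ampLeft : (H →L[ℂ] H) →⋆ₐ[ℂ] (Completion (H ⊗[ℂ] K) →L[ℂ] Completion (H ⊗[ℂ] K)) where
  toFun S := (TensorProduct.mapL S (ContinuousLinearMap.id ℂ K)).completion
  map_one' := completion_mapL_one
  map_mul' S T := completion_mapL_mul S T 1 1
  map_zero' := by
    rw [← zero_smul ℂ (0 : H →L[ℂ] H), TensorProduct.mapL_smul_left, completion_smul', zero_smul]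
  map_add' S T := by rw [TensorProduct.mapL_add_left, completion_add']
  commutes' r := by
    rw [Algebra.algebraMap_eq_smul_one, TensorProduct.mapL_smul_left, completion_smul',
      Algebra.algebraMap_eq_smul_one]
    exact congrArg (r • ·) completion_mapL_one
  map_star' S := by
    have := completion_mapL_star S (1 : K →L[ℂ] K)
    rwa [star_one] at this

/-- The amplification `T ↦ 1 ⊗ T`. -/
def ampRight : (K →L[ℂ] K) →⋆ₐ[ℂ] (Completion (H ⊗[ℂ] K) →L[ℂ] Completion (H ⊗[ℂ] K)) where
  toFun S := (TensorProduct.mapL (ContinuousLinearMap.id ℂ H) S).completion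
  map_one' := completion_mapL_one
  map_mul' S T := completion_mapL_mul 1 1 S T
  map_zero' := by
    rw [← zero_smul ℂ (0 : K →L[ℂ] K), TensorProduct.mapL_smul_right, completion_smul', zero_smul]
  map_add' S T := by rw [TensorProduct.mapL_add_right, completion_add']
  commutes' r := by
    rw [Algebra.algebraMap_eq_smul_one, TensorProduct.mapL_smul_right, completion_smul',
      Algebra.algebraMap_eq_smul_one]
    exact congrArg (r • ·) completion_mapL_one
  map_star' S := by
    have := completion_mapL_star (1 : H →L[ℂ] H) S
    rwa [star_one] at this

variable {H K}

theorem ampLeft_mul_ampRight (S : H →L[ℂ] H) (T : K →L[ℂ] K) :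
    ampLeft H K S * ampRight H K T = (TensorProduct.mapL S T).completion := by
  have := completion_mapL_mul S 1 1 T
  rw [mul_one, one_mul] at this
  exact this.symm

theorem ampRight_mul_ampLeft (S : H →L[ℂ] H) (T : K →L[ℂ] K) :
    ampRight H K T * ampLeft H K S = (TensorProduct.mapL S T).completion := by
  have := completion_mapL_mul 1 S T 1
  rw [mul_one, one_mul] at this
  exact this.symm

end Amplification

/-- A function which becomes a morphism after composition with an injective one is a morphism. -/
theorem exists_starAlgHom_of_injective {A C D : Type} [CStarAlgebra A] [CStarAlgebra C]
    [CStarAlgebra D] (j : C →⋆ₐ[ℂ] D) (hj : Function.Injective j) (ψ : A →⋆ₐ[ℂ] D) (f : A → C)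
    (h : ∀ a, j (f a) = ψ a) : ∃ L : A →⋆ₐ[ℂ] C, ∀ a, L a = f a := by
  refine ⟨{ toFun := f, map_one' := hj ?_, map_mul' := fun a b => hj ?_, map_zero' := hj ?_,
            map_add' := fun a b => hj ?_, commutes' := fun r => hj ?_,
            map_star' := fun a => hj ?_ }, fun a => rfl⟩
  · rw [h, map_one, map_one]
  · rw [h, map_mul, map_mul, h, h]
  · rw [h, map_zero, map_zero]
  · rw [h, map_add, map_add, h, h]
  · rw [h, AlgHomClass.commutes, AlgHomClass.commutes]
  · rw [h, map_star, map_star, h]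

namespace UnivCStar

/-- The evaluations at representatives are jointly injective, so every algebraic identity may be
checked in each component. -/
theorem exists_starAlgHom_of_ev {ι A : Type} [CStarAlgebra A] {R : FamilyClass ι} {b : ι → ℝ}
    (f : A → UnivCStar R b) (h : ∀ p, ∃ ψ : A →⋆ₐ[ℂ] Carrier p, ∀ a, ev p (f a) = ψ a) :
    ∃ L : A →⋆ₐ[ℂ] UnivCStar R b, ∀ a, L a = f a := by
  choose ψ h using h
  refine ⟨{ toFun := f, map_one' := ext_ev fun p => ?_, map_mul' := fun a b => ext_ev fun p => ?_,
            map_zero' := ext_ev fun p => ?_, map_add' := fun a b => ext_ev fun p => ?_,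
            commutes' := fun r => ext_ev fun p => ?_,
            map_star' := fun a => ext_ev fun p => ?_ }, fun a => rfl⟩
  · rw [h, map_one, map_one]
  · rw [h, map_mul, map_mul, h, h]
  · rw [h, map_zero, map_zero]
  · rw [h, map_add, map_add, h, h]
  · rw [h, AlgHomClass.commutes, AlgHomClass.commutes]
  · rw [h, map_star, map_star, h]

end UnivCStar

open UnivCStar

section Tensor

variable {A B A' B' : Type} [CStarAlgebra A] [CStarAlgebra B] [CStarAlgebra A'] [CStarAlgebra B']

/-- Under the embedding `j` the two legs become `π(a) ⊗ 1` and `1 ⊗ ρ(b)`; both orders of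
multiplication give `π(a) ⊗ ρ(b)`. -/
theorem SpatialClass.exists_homs {C : Type} [CStarAlgebra C] {f : A ⊕ B → C}
    (h : SpatialClass A B C f) :
    (∃ L : A →⋆ₐ[ℂ] C, ∀ a, L a = f (Sum.inl a)) ∧ (∃ L : B →⋆ₐ[ℂ] C, ∀ a, L a = f (Sum.inr a)) ∧
      ∀ a b, Commute (f (Sum.inl a)) (f (Sum.inr b)) := by
  obtain ⟨H, K, _, _, _, _, _, _, π, ρ, j, hj, h1, h2⟩ := h
  refine ⟨?_, ?_, fun a b => hj ?_⟩
  · exact exists_starAlgHom_of_injective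
      (D := UniformSpace.Completion (H ⊗[ℂ] K) →L[ℂ] UniformSpace.Completion (H ⊗[ℂ] K)) j hj
      ((ampLeft H K).comp π) _ h1
  · exact exists_starAlgHom_of_injective
      (D := UniformSpace.Completion (H ⊗[ℂ] K) →L[ℂ] UniformSpace.Completion (H ⊗[ℂ] K)) j hj
      ((ampRight H K).comp ρ) _ h2
  · rw [map_mul, map_mul, h1, h2]
    exact (ampLeft_mul_ampRight (π a) (ρ b)).trans (ampRight_mul_ampLeft (π a) (ρ b)).symm

/-- Precompose the two representations with `φ` and `ψ`, on the same Hilbert spaces and with the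
same embedding. This gives functoriality of the tensor product. -/
theorem SpatialClass.comap {C : Type} [CStarAlgebra C] {f : A' ⊕ B' → C}
    (h : SpatialClass A' B' C f) (φ : A →⋆ₐ[ℂ] A') (ψ : B →⋆ₐ[ℂ] B') :
    SpatialClass A B C (Sum.elim (fun a => f (Sum.inl (φ a))) fun b => f (Sum.inr (ψ b))) := by
  obtain ⟨H, K, _, _, _, _, _, _, π, ρ, j, hj, h1, h2⟩ := h
  exact ⟨H, K, _, _, ‹_›, _, _, ‹_›, π.comp φ, ρ.comp ψ, j, hj, fun a => h1 _, fun b => h2 _⟩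

variable (A B)

theorem exists_tensorLeft : ∃ L : A →⋆ₐ[ℂ] CTensor A B, ∀ a, L a = gen _ _ (Sum.inl a) :=
  exists_starAlgHom_of_ev _ fun p =>
    ⟨(family_mem p).exists_homs.1.choose, fun a => ((family_mem p).exists_homs.1.choose_spec a).symm⟩

theorem exists_tensorRight : ∃ L : B →⋆ₐ[ℂ] CTensor A B, ∀ a, L a = gen _ _ (Sum.inr a) :=
  exists_starAlgHom_of_ev _ fun p => ⟨(family_mem p).exists_homs.2.1.choose,
    fun a => ((family_mem p).exists_homs.2.1.choose_spec a).symm⟩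

/-- The morphism `a ↦ a ⊗ 1`. -/
def tensorLeft : A →⋆ₐ[ℂ] CTensor A B := (exists_tensorLeft A B).choose

/-- The morphism `b ↦ 1 ⊗ b`. -/
def tensorRight : B →⋆ₐ[ℂ] CTensor A B := (exists_tensorRight A B).choose

variable {A B}

theorem tensorLeft_apply (a : A) : tensorLeft A B a = gen _ _ (Sum.inl a) :=
  (exists_tensorLeft A B).choose_spec a

theorem tensorRight_apply (b : B) : tensorRight A B b = gen _ _ (Sum.inr b) :=
  (exists_tensorRight A B).choose_spec b

theorem ctmul_eq (a : A) (b : B) : ctmul a b = tensorLeft A B a * tensorRight A B b := by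
  rw [ctmul, tensorLeft_apply, tensorRight_apply]

theorem tensor_commute (a : A) (b : B) : Commute (tensorLeft A B a) (tensorRight A B b) := by
  rw [tensorLeft_apply, tensorRight_apply]
  refine ext_ev fun p => ?_
  rw [map_mul, map_mul]
  exact (family_mem p).exists_homs.2.2 a b

theorem ctmul_mul (a a' : A) (b b' : B) : ctmul a b * ctmul a' b' = ctmul (a * a') (b * b') := by
  simp only [ctmul_eq, map_mul]
  rw [mul_assoc, ← mul_assoc (tensorRight A B b), ← (tensor_commute a' b).eq]
  simp only [mul_assoc]

theorem ctmul_star (a : A) (b : B) : star (ctmul a b) = ctmul (star a) (star b) := by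
  simp only [ctmul_eq, star_mul, map_star]
  rw [← map_star, ← map_star, (tensor_commute _ _).eq]

@[simp]
theorem ctmul_one_one : ctmul (1 : A) (1 : B) = 1 := by simp [ctmul_eq]

@[simp]
theorem ctmul_zero_left (b : B) : ctmul (0 : A) b = 0 := by simp [ctmul_eq]

@[simp]
theorem ctmul_zero_right (a : A) : ctmul a (0 : B) = 0 := by simp [ctmul_eq]

theorem ctmul_sum_left {ι : Type} (s : Finset ι) (f : ι → A) (b : B) :
    ctmul (∑ i ∈ s, f i) b = ∑ i ∈ s, ctmul (f i) b := by
  simp [ctmul_eq, Finset.sum_mul]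

theorem ctmul_sum_right {ι : Type} (s : Finset ι) (a : A) (f : ι → B) :
    ctmul a (∑ i ∈ s, f i) = ∑ i ∈ s, ctmul a (f i) := by
  simp [ctmul_eq, Finset.mul_sum]

theorem ctmul_sub_left (a a' : A) (b : B) : ctmul (a - a') b = ctmul a b - ctmul a' b := by
  simp [ctmul_eq, sub_mul]

theorem ctmul_smul_right (r : ℂ) (a : A) (b : B) : ctmul a (r • b) = r • ctmul a b := by
  simp [ctmul_eq]

/-- Functoriality of the tensor product. -/
theorem exists_tensorMap (φ : A →⋆ₐ[ℂ] A') (ψ : B →⋆ₐ[ℂ] B') :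
    ∃ Φ : CTensor A B →⋆ₐ[ℂ] CTensor A' B', ∀ a b, Φ (ctmul a b) = ctmul (φ a) (ψ b) := by
  obtain ⟨Φ, hΦ⟩ := exists_hom_of_forall_ev (c := gen (SpatialClass A B) _) (R := SpatialClass A' B')
    (b := Sum.elim (fun a => ‖a‖) (fun b => ‖b‖)) generates_gen
    (f := Sum.elim (fun a => gen _ _ (Sum.inl (φ a))) fun b => gen _ _ (Sum.inr (ψ b)))
    (fun p => by
      obtain ⟨χ, hχ⟩ := exists_lift (b := Sum.elim (fun a => ‖a‖) (fun b => ‖b‖))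
        ((family_mem p).comap φ ψ) (by
          rintro (a | b)
          · exact (norm_family_le p _).trans (NonUnitalStarAlgHom.norm_apply_le φ a)
          · exact (norm_family_le p _).trans (NonUnitalStarAlgHom.norm_apply_le ψ b))
      refine ⟨χ, ?_⟩
      rintro (a | b) <;> exact hχ _)
  refine ⟨Φ, fun a b => ?_⟩
  rw [ctmul, map_mul, hΦ, hΦ]
  rfl

/-- The representation of the tensor product on the tensor product of two Hilbert spaces. -/
theorem exists_tensorRep {H K : Type} [NormedAddCommGroup H] [InnerProductSpace ℂ H]
    [CompleteSpace H] [NormedAddCommGroup K] [InnerProductSpace ℂ K] [CompleteSpace K]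
    (π : A →⋆ₐ[ℂ] (H →L[ℂ] H)) (ρ : B →⋆ₐ[ℂ] (K →L[ℂ] K)) :
    ∃ Ψ : CTensor A B →⋆ₐ[ℂ] (UniformSpace.Completion (H ⊗[ℂ] K) →L[ℂ]
      UniformSpace.Completion (H ⊗[ℂ] K)),
      ∀ a b, Ψ (ctmul a b) = (TensorProduct.mapL (π a) (ρ b)).completion := by
  obtain ⟨Ψ, hΨ⟩ := exists_lift (R := SpatialClass A B) (b := Sum.elim (fun a => ‖a‖) (fun b => ‖b‖))
    (f := Sum.elim (fun a => ampLeft H K (π a)) (fun b => ampRight H K (ρ b)))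
    ⟨H, K, _, _, ‹_›, _, _, ‹_›, π, ρ, StarAlgHom.id _ _, fun _ _ h => h, fun _ => rfl, fun _ => rfl⟩
    (by
      rintro (a | b)
      · exact NonUnitalStarAlgHom.norm_apply_le ((ampLeft H K).comp π) a
      · exact NonUnitalStarAlgHom.norm_apply_le ((ampRight H K).comp ρ) b)
  refine ⟨Ψ, fun a b => ?_⟩
  rw [ctmul, map_mul, hΨ, hΨ, ← ampLeft_mul_ampRight]
  rfl

/-- Slice maps: a vanishing tensor has vanishing slices. -/
theorem sum_slice_eq_zero {ι : Type} {s : Finset ι} {a : ι → A} {b : ι → B}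
    (h : ∑ i ∈ s, ctmul (a i) (b i) = 0) {K : Type} [NormedAddCommGroup K] [InnerProductSpace ℂ K]
    [CompleteSpace K] (ρ : B →⋆ₐ[ℂ] (K →L[ℂ] K)) (k k' : K) :
    ∑ i ∈ s, (inner ℂ k' (ρ (b i) k) : ℂ) • a i = 0 := by
  by_contra hne
  obtain ⟨H, _, _, _, π, ξ, hξ⟩ := exists_rep_ne_zero hne
  obtain ⟨Ψ, hΨ⟩ := exists_tensorRep π ρ
  -- With `η = π(slice) ξ`, the matrix coefficient of the vanishing tensor between `ξ ⊗ k` and `η ⊗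
  -- k'` equals `⟨η, η⟩`, which contradicts `η ≠ 0`.
  obtain ⟨η, hη⟩ : ∃ η, η = π (∑ i ∈ s, (inner ℂ k' (ρ (b i) k) : ℂ) • a i) ξ := ⟨_, rfl⟩
  rw [← hη] at hξ
  have h1 : inner ℂ ((η ⊗ₜ[ℂ] k' : H ⊗[ℂ] K) : UniformSpace.Completion (H ⊗[ℂ] K))
      (Ψ (∑ i ∈ s, ctmul (a i) (b i)) ((ξ ⊗ₜ[ℂ] k : H ⊗[ℂ] K) :)) = 0 := by simp [h]
  have h2 (i : ι) : inner ℂ ((η ⊗ₜ[ℂ] k' : H ⊗[ℂ] K) : UniformSpace.Completion (H ⊗[ℂ] K))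
      (Ψ (ctmul (a i) (b i)) ((ξ ⊗ₜ[ℂ] k : H ⊗[ℂ] K) :)) =
      inner ℂ η (π (a i) ξ) * inner ℂ k' (ρ (b i) k) := by
    rw [hΨ, ContinuousLinearMap.completion_apply_coe, UniformSpace.Completion.inner_coe,
      TensorProduct.mapL_tmul, TensorProduct.inner_tmul]
  rw [map_sum, sum_apply, inner_sum, Finset.sum_congr rfl fun i _ => h2 i] at h1
  apply hξ
  rw [← inner_self_eq_zero (𝕜 := ℂ), ← h1]
  have h3 : inner ℂ η η = inner ℂ η (π (∑ i ∈ s, (inner ℂ k' (ρ (b i) k) : ℂ) • a i) ξ) := by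
    rw [← hη]
  rw [h3, map_sum, sum_apply, inner_sum]
  refine Finset.sum_congr rfl fun i _ => ?_
  rw [map_smul, smul_apply, inner_smul_right, mul_comm]

end Tensor

open UnivCStar NCSpace

/-! ### Subspaces and intersections -/

namespace NCSpace

variable {ι : Type} {X Y Z : NCSpace ι}

/-- Density comes for free: the range contains all *-polynomials in the coordinates of `X`. -/
theorem IsSubspace.of_hom (hX : Generates X.coord) (φ : Y.alg →⋆ₐ[ℂ] X.alg)
    (h : ∀ i, φ (Y.coord i) = X.coord i) : IsSubspace X Y := by
  refine ⟨φ, hX.mono ?_, h⟩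
  rintro _ ⟨P, rfl⟩
  exact ⟨starEval Y.coord P, by rw [map_starEval, funext h]⟩

theorem IsSubspace.generates (h : IsSubspace X Y) (hY : Generates Y.coord) :
    Generates X.coord := by
  obtain ⟨φ, hd, h⟩ := h
  have := hY.map φ hd
  rwa [funext h] at this

theorem IsSubspace.trans (hXY : IsSubspace X Y) (hYZ : IsSubspace Y Z) : IsSubspace X Z := by
  obtain ⟨φ, hd, h⟩ := hXY
  obtain ⟨ψ, hd', h'⟩ := hYZ
  exact ⟨φ.comp ψ, hd.comp hd' (starAlgHom_continuous φ), fun i => by simp [h, h']⟩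

theorem IsSubspace.refl (X : NCSpace ι) : IsSubspace X X :=
  ⟨StarAlgHom.id ℂ _, Function.surjective_id.denseRange, fun _ => rfl⟩

theorem Same.of_homs (hX : Generates X.coord) (hY : Generates Y.coord) (φ : X.alg →⋆ₐ[ℂ] Y.alg)
    (hφ : ∀ i, φ (X.coord i) = Y.coord i) (ψ : Y.alg →⋆ₐ[ℂ] X.alg)
    (hψ : ∀ i, ψ (Y.coord i) = X.coord i) : Same X Y := by
  have h1 : ψ.comp φ = StarAlgHom.id ℂ _ := hX.hom_ext fun i => by simp [hφ, hψ]
  have h2 : φ.comp ψ = StarAlgHom.id ℂ _ := hY.hom_ext fun i => by simp [hφ, hψ]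
  exact ⟨StarAlgEquiv.ofStarAlgHom φ ψ h1 h2, hφ⟩

theorem Same.of_isSubspace (hY : Generates Y.coord) (h : IsSubspace X Y) (h' : IsSubspace Y X) :
    Same X Y := by
  obtain ⟨φ, -, hφ⟩ := id h
  obtain ⟨ψ, -, hψ⟩ := h'
  exact Same.of_homs (h.generates hY) hY ψ hψ φ hφ

theorem generates_univ (R : FamilyClass ι) : Generates (univ R).coord := generates_gen

theorem exists_lift_univ {R : FamilyClass ι} {C : Type} [CStarAlgebra C] {f : ι → C} (hR : R C f)
    (hb : ∀ i, ‖f i‖ ≤ 1) : ∃ φ : (univ R).alg →⋆ₐ[ℂ] C, ∀ i, φ ((univ R).coord i) = f i :=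
  exists_lift (b := fun _ => 1) hR hb

theorem generates_inter (X Y : NCSpace ι) : Generates (inter X Y).coord := generates_gen

theorem exists_lift_inter {C : Type} [CStarAlgebra C] (φ : X.alg →⋆ₐ[ℂ] C) (ψ : Y.alg →⋆ₐ[ℂ] C)
    (h : ∀ i, φ (X.coord i) = ψ (Y.coord i)) :
    ∃ χ : (inter X Y).alg →⋆ₐ[ℂ] C, ∀ i, χ ((inter X Y).coord i) = φ (X.coord i) :=
  exists_lift (b := fun i => ‖X.coord i‖) ⟨⟨φ, fun _ => rfl⟩, ψ, fun i => (h i).symm⟩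
    fun _ => NonUnitalStarAlgHom.norm_apply_le φ _

/-- By definition each representative of the intersection receives a morphism from `C(X)`, and these
assemble componentwise. -/
theorem inter_isSubspace_left (hX : Generates X.coord) : IsSubspace (inter X Y) X := by
  obtain ⟨φ, hφ⟩ := exists_hom_of_forall_ev hX (f := (inter X Y).coord)
    fun p => (family_mem p).1
  exact IsSubspace.of_hom (generates_inter X Y) φ hφ

theorem inter_isSubspace_right (hY : Generates Y.coord) : IsSubspace (inter X Y) Y := by
  obtain ⟨φ, hφ⟩ := exists_hom_of_forall_ev hY (f := (inter X Y).coord)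
    fun p => (family_mem p).2
  exact IsSubspace.of_hom (generates_inter X Y) φ hφ

theorem IsSubspace.inter (hZ : Generates Z.coord) (hX : IsSubspace Z X) (hY : IsSubspace Z Y) :
    IsSubspace Z (inter X Y) := by
  obtain ⟨φ, -, hφ⟩ := hX
  obtain ⟨ψ, -, hψ⟩ := hY
  obtain ⟨χ, hχ⟩ := exists_lift_inter φ ψ fun i => by rw [hφ, hψ]
  exact IsSubspace.of_hom hZ χ fun i => by rw [hχ, hφ]

end NCSpace

section

variable {N : ℕ}

theorem IsQuantumGroup.generates {G : NCSpace (Fin N × Fin N)} (hG : IsQuantumGroup G) :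
    Generates G.coord := hG.subspace.generates (generates_univ _)

theorem ActsOn.of_isSubspace {L K : NCSpace (Fin N × Fin N)} {X : NCSpace (Fin N)}
    (hK : ActsOn K X) (h : IsSubspace L K) : ActsOn L X := by
  obtain ⟨Φ, hΦ⟩ := hK
  obtain ⟨φ, -, hφ⟩ := h
  obtain ⟨T, hT⟩ := exists_tensorMap φ (StarAlgHom.id ℂ X.alg)
  exact ⟨T.comp Φ, fun i => by simp [hΦ, hT, hφ]⟩

theorem exists_opHom {A B : Type} [CStarAlgebra A] [CStarAlgebra B] (θ : A →⋆ₐ[ℂ] B) :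
    ∃ θ' : Aᵐᵒᵖ →⋆ₐ[ℂ] Bᵐᵒᵖ, ∀ a, θ' (MulOpposite.op a) = MulOpposite.op (θ a) := by
  refine ⟨{ AlgHom.op θ.toAlgHom with map_star' := fun a => MulOpposite.unop_injective ?_ },
    fun a => rfl⟩
  change θ (star a.unop) = star (θ a.unop)
  rw [map_star]

/-- Pushed into the algebra of the intersection (tensored with itself, for `Δ`; opposite, for `S`),
the structure maps of `K` and `M` agree on coordinates, so the universal property joins them. -/
theorem IsQuantumGroup.inter {K M : NCSpace (Fin N × Fin N)} (hK : IsQuantumGroup K)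
    (hM : IsQuantumGroup M) : IsQuantumGroup (inter K M) := by
  obtain ⟨φ, -, hφ⟩ := inter_isSubspace_left (Y := M) hK.generates
  obtain ⟨ψ, -, hψ⟩ := inter_isSubspace_right (X := K) hM.generates
  refine ⟨(inter_isSubspace_left hK.generates).trans hK.subspace, ?_, ?_, ?_⟩
  · obtain ⟨Δ, hΔ⟩ := hK.comul
    obtain ⟨Δ', hΔ'⟩ := hM.comul
    obtain ⟨T, hT⟩ := exists_tensorMap φ φ
    obtain ⟨T', hT'⟩ := exists_tensorMap ψ ψ
    obtain ⟨χ, hχ⟩ := exists_lift_inter (T.comp Δ) (T'.comp Δ') fun p => by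
      simp [hΔ p.1 p.2, hΔ' p.1 p.2, hT, hT', hφ, hψ]
    exact ⟨χ, fun i j => by simp [hχ, hΔ, hT, hφ]⟩
  · obtain ⟨ε, hε⟩ := hK.counit
    obtain ⟨ε', hε'⟩ := hM.counit
    obtain ⟨χ, hχ⟩ := exists_lift_inter ε ε' fun p => by rw [hε p.1 p.2, hε' p.1 p.2]
    exact ⟨χ, fun i j => by rw [hχ, hε]⟩
  · obtain ⟨S, hS⟩ := hK.antipode
    obtain ⟨S', hS'⟩ := hM.antipode
    obtain ⟨T, hT⟩ := exists_opHom φ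
    obtain ⟨T', hT'⟩ := exists_opHom ψ
    obtain ⟨χ, hχ⟩ := exists_lift_inter (T.comp S) (T'.comp S') fun p => by
      simp [hS p.1 p.2, hS' p.1 p.2, hT, hT', hφ, hψ]
    exact ⟨χ, fun i j => by simp [hχ, hS, hT, hφ]⟩

/-- The largest quantum group in `M` acting on `X` is the intersection with `M` of the quantum
isometry group. -/
theorem IsLargestActing.same_inter {M : NCSpace (Fin N × Fin N)} (hM : IsQuantumGroup M)
    {X : NCSpace (Fin N)} {G K : NCSpace (Fin N × Fin N)} (hG : IsLargestActing M X G)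
    (hK : IsQuantumIsometryGroup X K) : Same (inter K M) G := by
  have hL : IsQuantumGroup (inter K M) := hK.isQuantumGroup.inter hM
  -- The intersection acts by restriction from `K`, so maximality of `G` applies; conversely
  -- maximality of `K` contains `G`, which already lies in `M`.
  refine Same.of_isSubspace hG.isQuantumGroup.generates ?_ ?_
  · exact hG.largest _ hL (inter_isSubspace_right hM.generates)
      (hK.acts.of_isSubspace (inter_isSubspace_left hK.isQuantumGroup.generates))
  · exact IsSubspace.inter hG.isQuantumGroup.generates
      (hK.largest _ hG.isQuantumGroup hG.isQuantumGroup.subspace hG.acts) hG.subspace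

end

/-! ### Relations between coordinates -/

/-- Since `x_i^2 ≤ ∑ x_j^2 = 1`, the C*-identity bounds the norm. Hence the norm bounds in the
universal algebras follow from the relations. -/
theorem norm_le_one_of_sum_mul_self {ι A : Type} [CStarAlgebra A] {s : Finset ι} {x : ι → A}
    (hsa : ∀ i, IsSelfAdjoint (x i)) (h : ∑ i ∈ s, x i * x i = 1) {i : ι} (hi : i ∈ s) :
    ‖x i‖ ≤ 1 := by
  rcases subsingleton_or_nontrivial A with _ | _
  · rw [Subsingleton.elim (x i) 0, norm_zero]; exact zero_le_one
  let _ := CStarAlgebra.spectralOrder A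
  have := CStarAlgebra.spectralOrderedRing A
  have hnn (j : ι) : 0 ≤ x j * x j := by
    simpa [(hsa j).star_eq] using star_mul_self_nonneg (x j)
  have hle : x i * x i ≤ 1 := h ▸ Finset.single_le_sum (fun j _ => hnn j) hi
  have h1 := CStarAlgebra.norm_le_norm_of_nonneg_of_le (hnn i) hle
  rw [norm_one, ← (hsa i).star_eq] at h1
  nth_rewrite 2 [(hsa i).star_eq] at h1
  rw [CStarRing.norm_star_mul_self] at h1
  nlinarith [norm_nonneg (x i)]

/-- The C*-identity applies to `(ab)^* (ab) = b^* (a a b)`. -/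
theorem mul_eq_zero_of_mul_self_mul {A : Type} [CStarAlgebra A] {a b : A} (ha : IsSelfAdjoint a)
    (h : a * a * b = 0) : a * b = 0 := by
  rw [← CStarRing.star_mul_self_eq_zero_iff, star_mul, ha.star_eq, mul_assoc, ← mul_assoc a, h,
    mul_zero]

section Relations

variable (N : ℕ)

/-- The relations of `H_N^{[∞]}`. -/
def InftyRel : FamilyClass (Fin N × Fin N) := fun C _ u =>
  OrthRel N C u ∧ ∀ p q r, Aligned p r → u p * u q * u r = 0

/-- The relations of `H_N^*`. -/
def StarRel : FamilyClass (Fin N × Fin N) := fun C _ u =>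
  OrthRel N C u ∧ (∀ p q, Aligned p q → u p * u q = 0) ∧
    ∀ p q r, u p * u q * u r = u r * u q * u p

/-- The relations of `H_N`: those of `H_N^*` together with commutation. -/
def ClassRel : FamilyClass (Fin N × Fin N) := fun C _ u =>
  OrthRel N C u ∧ (∀ p q, Aligned p q → u p * u q = 0) ∧ ∀ p q, u p * u q = u q * u p

/-- The relations of the usual sphere. -/
def RealSphereRel : FamilyClass (Fin N) := fun C _ x =>
  FreeSphereRel N C x ∧ ∀ i j, x i * x j = x j * x i

/-- The relations of the half-liberated sphere. -/
def HalfSphereRel : FamilyClass (Fin N) := fun C _ x =>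
  FreeSphereRel N C x ∧ ∀ i j k, x i * x j * x k = x k * x j * x i

/-- The relations of the sphere `S_{ℝ,∞}`. -/
def InftySphereRel : FamilyClass (Fin N) := fun C _ x =>
  FreeSphereRel N C x ∧ ∀ i j, x i ^ 2 * x j = x j * x i ^ 2

end Relations

section

variable {N : ℕ} {A B : Type} [CStarAlgebra A] [CStarAlgebra B]

theorem OrthRel.norm_le {u : Fin N × Fin N → A} (hu : OrthRel N A u) (p : Fin N × Fin N) :
    ‖u p‖ ≤ 1 :=
  norm_le_one_of_sum_mul_self (x := fun k => u (p.1, k)) (fun _ => hu.1 _)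
    (by simpa using hu.2.1 p.1 p.1) (Finset.mem_univ p.2)

theorem FreeSphereRel.norm_le {x : Fin N → A} (hx : FreeSphereRel N A x) (i : Fin N) :
    ‖x i‖ ≤ 1 :=
  norm_le_one_of_sum_mul_self hx.1 (by simpa [sq] using hx.2) (Finset.mem_univ i)

theorem OrthRel.map {u : Fin N × Fin N → A} (hu : OrthRel N A u) (φ : A →⋆ₐ[ℂ] B) :
    OrthRel N B fun p => φ (u p) := by
  refine ⟨fun p => (hu.1 p).map φ, fun i j => ?_, fun i j => ?_⟩
  · simp only [← map_mul, ← map_sum, hu.2.1]; split_ifs <;> simp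
  · simp only [← map_mul, ← map_sum, hu.2.2]; split_ifs <;> simp

theorem InftyRel.map {u : Fin N × Fin N → A} (hu : InftyRel N A u) (φ : A →⋆ₐ[ℂ] B) :
    InftyRel N B fun p => φ (u p) :=
  ⟨hu.1.map φ, fun p q r h => by simp only [← map_mul, hu.2 p q r h, map_zero]⟩

theorem FreeSphereRel.map {x : Fin N → A} (hx : FreeSphereRel N A x) (φ : A →⋆ₐ[ℂ] B) :
    FreeSphereRel N B fun i => φ (x i) :=
  ⟨fun i => (hx.1 i).map φ, by simp only [← map_pow, ← map_sum, hx.2, map_one]⟩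

/-! ### The defining relations, for the universal generators themselves. -/

section Univ

variable {ι : Type} {R : FamilyClass ι} {b : ι → ℝ}

theorem orthRel_gen {R : FamilyClass (Fin N × Fin N)} {b : Fin N × Fin N → ℝ}
    (h : ∀ (C : Type) [CStarAlgebra C] u, R C u → OrthRel N C u) :
    OrthRel N (UnivCStar R b) (gen R b) := by
  refine ⟨fun q => ext_ev fun p => ?_, fun i j => ext_ev fun p => ?_, fun i j => ext_ev fun p => ?_⟩
  all_goals have := h _ _ (family_mem p)
  · rw [map_star]; exact this.1 q
  · rw [map_sum]; simp only [map_mul, ev_gen, this.2.1]; split_ifs <;> simp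
  · rw [map_sum]; simp only [map_mul, ev_gen, this.2.2]; split_ifs <;> simp

theorem freeSphereRel_gen {R : FamilyClass (Fin N)} {b : Fin N → ℝ}
    (h : ∀ (C : Type) [CStarAlgebra C] u, R C u → FreeSphereRel N C u) :
    FreeSphereRel N (UnivCStar R b) (gen R b) := by
  refine ⟨fun q => ext_ev fun p => ?_, ext_ev fun p => ?_⟩
  all_goals have := h _ _ (family_mem p)
  · rw [map_star]; exact this.1 q
  · rw [map_sum]; simp only [map_pow, ev_gen, this.2, map_one]

theorem gen_mul_mul_eq_zero {p q r : ι}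
    (h : ∀ (C : Type) [CStarAlgebra C] v, R C v → v p * v q * v r = 0) :
    gen R b p * gen R b q * gen R b r = 0 :=
  ext_ev fun e => by simp only [map_mul, map_zero]; exact h _ _ (family_mem e)

theorem gen_mul_eq_zero {p q : ι}
    (h : ∀ (C : Type) [CStarAlgebra C] v, R C v → v p * v q = 0) :
    gen R b p * gen R b q = 0 :=
  ext_ev fun e => by simp only [map_mul, map_zero]; exact h _ _ (family_mem e)

/-- Stated for lists so that it serves all the monomial relations: those of `H_N^*`, of the spheres
and of the group spheres. -/
theorem gen_list_prod_eq {l l' : List ι}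
    (h : ∀ (C : Type) [CStarAlgebra C] v, R C v → (l.map v).prod = (l'.map v).prod) :
    (l.map (gen R b)).prod = (l'.map (gen R b)).prod :=
  ext_ev fun e => by
    simp only [map_list_prod, List.map_map]; exact h _ _ (family_mem e)

theorem inftyRel_HInfty : InftyRel N (HInfty N).alg (HInfty N).coord :=
  ⟨orthRel_gen fun _ _ _ h => h.1, fun _ _ _ hp => gen_mul_mul_eq_zero fun _ _ _ h => h.2 _ _ _ hp⟩

theorem starRel_HStar : StarRel N (HStar N).alg (HStar N).coord :=
  ⟨orthRel_gen fun _ _ _ h => h.1, fun _ _ hp => gen_mul_eq_zero fun _ _ _ h => h.2.1 _ _ hp,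
    fun p q r => by
      have := gen_list_prod_eq (R := StarRel N) (b := fun _ => 1) (l := [p, q, r])
        (l' := [r, q, p]) fun _ _ _ h => by simpa [← mul_assoc] using h.2.2 p q r
      simp only [List.map_cons, List.map_nil, List.prod_cons, List.prod_nil, mul_one,
        ← mul_assoc] at this
      exact this⟩

theorem halfSphereRel_halfSphere : HalfSphereRel N (halfSphere N).alg (halfSphere N).coord :=
  ⟨freeSphereRel_gen fun _ _ _ h => h.1, fun i j k => by
    have := gen_list_prod_eq (R := HalfSphereRel N) (b := fun _ => 1) (l := [i, j, k])
      (l' := [k, j, i]) fun _ _ _ h => by simpa [← mul_assoc] using h.2 i j k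
    simp only [List.map_cons, List.map_nil, List.prod_cons, List.prod_nil, mul_one,
      ← mul_assoc] at this
    exact this⟩

theorem inftySphereRel_inftySphere : InftySphereRel N (inftySphere N).alg (inftySphere N).coord :=
  ⟨freeSphereRel_gen fun _ _ _ h => h.1, fun i j => by
    have := gen_list_prod_eq (R := InftySphereRel N) (b := fun _ => 1) (l := [i, i, j])
      (l' := [j, i, i]) fun _ _ _ h => by simpa [← mul_assoc, sq] using h.2 i j
    simp only [List.map_cons, List.map_nil, List.prod_cons, List.prod_nil, mul_one,
      ← mul_assoc] at this
    simp only [sq, ← mul_assoc]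
    exact this⟩

end Univ

/-! ### Consequences of the relations -/

theorem Aligned.symm {p q : Fin N × Fin N} (h : Aligned p q) : Aligned q p :=
  ⟨h.1.symm, h.2.imp Eq.symm Eq.symm⟩

/-- Taking the middle entry equal to the first gives `a a c = 0`, and self-adjointness reduces this
to `a c = 0`. -/
theorem InftyRel.mul_eq_zero {u : Fin N × Fin N → A} (hu : InftyRel N A u) {p q : Fin N × Fin N}
    (h : Aligned p q) : u p * u q = 0 :=
  mul_eq_zero_of_mul_self_mul (hu.1.1 p) (hu.2 p p q h)

/-- With `a, b, c` the three entries, `(abc)(abc)^* = ab(ccb)a = abbc(ca)`, where half-commutation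
moves `cc` across `b`, and `ca = 0` by alignment. -/
theorem StarRel.inftyRel {u : Fin N × Fin N → A} (hu : StarRel N A u) : InftyRel N A u := by
  refine ⟨hu.1, fun p q r h => ?_⟩
  have h1 : star (u p * u q * u r) = u r * u q * u p := by
    simp only [star_mul, (hu.1.1 _).star_eq, mul_assoc]
  rw [← CStarRing.mul_star_self_eq_zero_iff, h1]
  have h2 : u r * u r * u q = u q * u r * u r := hu.2.2 r r q
  have h3 : u r * u p = 0 := hu.2.1 r p h.symm
  calc u p * u q * u r * (u r * u q * u p) = u p * u q * (u r * u r * u q) * u p := by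
        simp only [mul_assoc]
    _ = u p * u q * u q * u r * (u r * u p) := by rw [h2]; simp only [mul_assoc]
    _ = 0 := by rw [h3, mul_zero]

theorem ClassRel.starRel {u : Fin N × Fin N → A} (hu : ClassRel N A u) : StarRel N A u :=
  ⟨hu.1, hu.2.1, fun p q r => by
    rw [hu.2.2 p q, mul_assoc, hu.2.2 p r, ← mul_assoc, hu.2.2 q r]⟩

/-- The projections `u_p^2` are central. -/
theorem InftyRel.sq_commute {u : Fin N × Fin N → A} (hu : InftyRel N A u) (p q : Fin N × Fin N) :
    u p * u p * u q = u q * (u p * u p) := by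
  have hp : ∀ k, k ≠ p.2 → Aligned p (p.1, k) := fun k hk =>
    ⟨fun h => hk (by rw [h]), Or.inl rfl⟩
  have hsum : ∑ k, u (p.1, k) * u (p.1, k) = 1 := by simpa using hu.1.2.1 p.1 p.1
  -- Insert `1 = ∑_k u_ik^2` along the row of `p`: only `k = p.2` survives, as the other terms
  -- contain a vanishing triple product. Both sides of the claim thus equal `u_p^2 u_q u_p^2`.
  have h1 : u p * u p * u q = u p * u p * u q * (u p * u p) := by
    conv_lhs => rw [← mul_one (u p * u p * u q), ← hsum, Finset.mul_sum]
    refine Finset.sum_eq_single_of_mem p.2 (Finset.mem_univ _) fun k _ hk => ?_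
    have := hu.2 p q (p.1, k) (hp k hk)
    rw [← mul_assoc, mul_assoc (u p), mul_assoc (u p), this, mul_zero, zero_mul]
  have h2 : u q * (u p * u p) = u p * u p * u q * (u p * u p) := by
    conv_lhs => rw [← one_mul (u q * (u p * u p)), ← hsum, Finset.sum_mul]
    refine (Finset.sum_eq_single_of_mem p.2 (Finset.mem_univ _) fun k _ hk => ?_).trans (by
      simp only [mul_assoc, Prod.mk.eta])
    have := hu.2 (p.1, k) q p (hp k hk).symm
    rw [mul_assoc, ← mul_assoc (u (p.1, k)) (u q), ← mul_assoc _ (u p), this, zero_mul, mul_zero]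
  rw [h1, ← h2]

/-- Multiply `u_p` by `1 = ∑_k u_ik^2` along its row; all terms but one vanish. So `u_p^2` is a
projection acting as a unit on `u_p`. -/
theorem InftyRel.cube_eq {u : Fin N × Fin N → A} (hu : InftyRel N A u) (p : Fin N × Fin N) :
    u p * u p * u p = u p := by
  have hsum : ∑ k, u (p.1, k) * u (p.1, k) = 1 := by simpa using hu.1.2.1 p.1 p.1
  conv_rhs => rw [← mul_one (u p), ← hsum, Finset.mul_sum]
  symm
  refine (Finset.sum_eq_single_of_mem p.2 (Finset.mem_univ _) fun k _ hk => ?_).trans (by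
      simp only [mul_assoc, Prod.mk.eta])
  rw [← mul_assoc, hu.mul_eq_zero (p := p) (q := (p.1, k)) ⟨fun h => hk (by rw [h]), Or.inl rfl⟩,
    zero_mul]

/-! ### The affine action formula -/

/-- The elements `∑_j u_ij ⊗ x_j`. -/
def tact (u : Fin N × Fin N → A) (x : Fin N → B) (i : Fin N) : CTensor A B :=
  ∑ j, ctmul (u (i, j)) (x j)

variable {u : Fin N × Fin N → A} {x x' x'' : Fin N → B}

theorem tact_selfAdjoint (hu : ∀ p, IsSelfAdjoint (u p)) (hx : ∀ i, IsSelfAdjoint (x i))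
    (i : Fin N) : IsSelfAdjoint (tact u x i) := by
  rw [isSelfAdjoint_iff, tact, star_sum]
  exact Finset.sum_congr rfl fun j _ => by rw [ctmul_star, (hu _).star_eq, (hx _).star_eq]

theorem tact_mul (i j : Fin N) : tact u x i * tact u x' j =
    ∑ a, ∑ b, ctmul (u (i, a) * u (j, b)) (x a * x' b) := by
  simp only [tact, Finset.sum_mul_sum, ctmul_mul]

theorem tact_mul_mul (i j k : Fin N) : tact u x i * tact u x' j * tact u x'' k =
    ∑ a, ∑ b, ∑ c, ctmul (u (i, a) * u (j, b) * u (k, c)) (x a * x' b * x'' c) := by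
  rw [tact_mul, tact]
  rw [Finset.sum_mul]
  refine Finset.sum_congr rfl fun a _ => ?_
  rw [Finset.sum_mul]
  refine Finset.sum_congr rfl fun b _ => ?_
  rw [Finset.mul_sum]
  exact Finset.sum_congr rfl fun c _ => ctmul_mul _ _ _ _

/-- Summing over the row index first, orthogonality of the columns of `u` leaves only the diagonal
terms. -/
theorem sum_tact_mul (hu : OrthRel N A u) :
    ∑ i, tact u x i * tact u x' i = ctmul 1 (∑ a, x a * x' a) := by
  simp only [tact_mul]
  rw [Finset.sum_comm, ctmul_sum_right]
  refine Finset.sum_congr rfl fun a _ => ?_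
  rw [Finset.sum_comm]
  simp only [← ctmul_sum_left, hu.2.2]
  rw [Finset.sum_eq_single_of_mem a (Finset.mem_univ _)]
  · rw [if_pos rfl]
  · intro b _ hb
    rw [if_neg hb.symm, ctmul_zero_left]

theorem tact_freeSphereRel (hu : OrthRel N A u) (hx : FreeSphereRel N B x) :
    FreeSphereRel N (CTensor A B) (tact u x) := by
  refine ⟨tact_selfAdjoint hu.1 hx.1, ?_⟩
  have h := hx.2
  simp only [sq] at h ⊢
  rw [sum_tact_mul hu, h, ctmul_one_one]

/-- Two families `x`, `x'` are allowed because the comultiplied coordinates are this action applied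
to different columns of the second matrix. -/
theorem tact_comm (hu : ∀ p q, u p * u q = u q * u p) (hx : ∀ i j, x i * x' j = x' j * x i)
    (i j : Fin N) : tact u x i * tact u x' j = tact u x' j * tact u x i := by
  rw [tact_mul, tact_mul, Finset.sum_comm]
  exact Finset.sum_congr rfl fun b _ => Finset.sum_congr rfl fun a _ => by rw [hu, hx]

theorem tact_half (hu : ∀ p q r, u p * u q * u r = u r * u q * u p)
    (hx : ∀ i j k, x i * x' j * x'' k = x'' k * x' j * x i) (i j k : Fin N) :
    tact u x i * tact u x' j * tact u x'' k = tact u x'' k * tact u x' j * tact u x i := by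
  rw [tact_mul_mul, tact_mul_mul, Finset.sum_comm]
  refine (Finset.sum_congr rfl fun b _ => Finset.sum_comm).trans ?_
  rw [Finset.sum_comm]
  refine Finset.sum_congr rfl fun c _ => Finset.sum_congr rfl fun b _ =>
    Finset.sum_congr rfl fun a _ => by rw [hu, hx]

theorem tact_mul_self (hu : ∀ p q, Aligned p q → u p * u q = 0) (i : Fin N) :
    tact u x i * tact u x' i = ∑ a, ctmul (u (i, a) * u (i, a)) (x a * x' a) := by
  rw [tact_mul]
  refine Finset.sum_congr rfl fun a _ => Finset.sum_eq_single_of_mem a (Finset.mem_univ _)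
    fun b _ hb => ?_
  rw [hu (i, a) (i, b) ⟨fun h => hb (congrArg Prod.snd h).symm, Or.inl rfl⟩, ctmul_zero_left]

/-- Vanishing of aligned products makes the square diagonal, `∑_a u_ia^2 ⊗ x_a^2`, and both legs of
each term commute with the corresponding coordinates. -/
theorem tact_inftySphereRel (hu : InftyRel N A u) (hx : InftySphereRel N B x) :
    InftySphereRel N (CTensor A B) (tact u x) := by
  refine ⟨tact_freeSphereRel hu.1 hx.1, fun i j => ?_⟩
  rw [sq, tact_mul_self fun p q h => hu.mul_eq_zero h, tact, Finset.sum_mul_sum,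
    Finset.sum_mul_sum, Finset.sum_comm]
  refine Finset.sum_congr rfl fun b _ => Finset.sum_congr rfl fun a _ => ?_
  rw [ctmul_mul, ctmul_mul, hu.sq_commute, ← sq (x a), hx.2]

/-! ### Comultiplication, counit, antipode -/

/-- The comultiplied coordinates `∑_k u_ik ⊗ u'_kj`. -/
def comulFam (u : Fin N × Fin N → A) (u' : Fin N × Fin N → B) (p : Fin N × Fin N) : CTensor A B :=
  tact u (fun k => u' (k, p.2)) p.1

variable {u' : Fin N × Fin N → B}

theorem OrthRel.comul (hu : OrthRel N A u) (hu' : OrthRel N B u') :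
    OrthRel N (CTensor A B) (comulFam u u') := by
  refine ⟨fun p => tact_selfAdjoint hu.1 (fun _ => hu'.1 _) _, fun i j => ?_, fun i j => ?_⟩
  · simp only [comulFam, tact_mul]
    rw [Finset.sum_comm]
    simp only [fun a => Finset.sum_comm (s := Finset.univ) (t := Finset.univ)
      (f := fun k b => ctmul (u (i, a) * u (j, b)) (u' (a, k) * u' (b, k))), ← ctmul_sum_right,
      hu'.2.1]
    have (a : Fin N) : ∑ b, ctmul (u (i, a) * u (j, b)) (if a = b then (1 : B) else 0) =
        ctmul (u (i, a) * u (j, a)) 1 := by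
      rw [Finset.sum_eq_single_of_mem a (Finset.mem_univ _), if_pos rfl]
      intro b _ hb
      rw [if_neg hb.symm, ctmul_zero_right]
    simp only [this, ← ctmul_sum_left, hu.2.1]
    split_ifs <;> simp
  · simp only [comulFam, sum_tact_mul hu, hu'.2.2]
    split_ifs <;> simp

/-- For `p`, `r` on a common row, the first alternative holds when `a ≠ c` and the second when `a =
c`; on a common column the roles are exchanged. So each term in an expanded product of comultiplied
aligned entries dies in one of its legs. -/
theorem aligned_or_aligned {p r : Fin N × Fin N} (h : Aligned p r) (a c : Fin N) :
    Aligned (p.1, a) (r.1, c) ∨ Aligned (a, p.2) (c, r.2) := by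
  obtain ⟨i, j⟩ := p
  obtain ⟨k, l⟩ := r
  obtain ⟨h1, h2⟩ := h
  simp only [Aligned, ne_eq, Prod.mk.injEq, not_and] at *
  grind

theorem InftyRel.comul (hu : InftyRel N A u) (hu' : InftyRel N B u') :
    InftyRel N (CTensor A B) (comulFam u u') := by
  refine ⟨hu.1.comul hu'.1, fun p q r h => ?_⟩
  simp only [comulFam, tact_mul_mul]
  refine Finset.sum_eq_zero fun a _ => Finset.sum_eq_zero fun b _ => Finset.sum_eq_zero fun c _ => ?_
  rcases aligned_or_aligned h a c with h | h
  · rw [hu.2 _ _ _ h, ctmul_zero_left]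
  · rw [hu'.2 _ _ _ h, ctmul_zero_right]

theorem comul_mul_eq_zero (hu : ∀ p q, Aligned p q → u p * u q = 0)
    (hu' : ∀ p q, Aligned p q → u' p * u' q = 0) (p q : Fin N × Fin N) (h : Aligned p q) :
    comulFam u u' p * comulFam u u' q = 0 := by
  simp only [comulFam, tact_mul]
  refine Finset.sum_eq_zero fun a _ => Finset.sum_eq_zero fun c _ => ?_
  rcases aligned_or_aligned h a c with h | h
  · rw [hu _ _ h, ctmul_zero_left]
  · rw [hu' _ _ h, ctmul_zero_right]

theorem StarRel.comul (hu : StarRel N A u) (hu' : StarRel N B u') :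
    StarRel N (CTensor A B) (comulFam u u') :=
  ⟨hu.1.comul hu'.1, comul_mul_eq_zero hu.2.1 hu'.2.1,
    fun _ _ _ => tact_half hu.2.2 (fun _ _ _ => hu'.2.2 _ _ _) _ _ _⟩

theorem ClassRel.comul (hu : ClassRel N A u) (hu' : ClassRel N B u') :
    ClassRel N (CTensor A B) (comulFam u u') :=
  ⟨hu.1.comul hu'.1, comul_mul_eq_zero hu.2.1 hu'.2.1,
    fun _ _ => tact_comm hu.2.2 (fun _ _ => hu'.2.2 _ _) _ _⟩

variable (N) in
/-- The coordinates of the unit. -/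
def unitFam (p : Fin N × Fin N) : ℂ := if p.1 = p.2 then 1 else 0

theorem classRel_unitFam : ClassRel N ℂ (unitFam N) := by
  refine ⟨⟨fun p => ?_, fun i j => ?_, fun i j => ?_⟩, fun p q h => ?_, fun p q => mul_comm _ _⟩
  · rw [isSelfAdjoint_iff, unitFam]; split_ifs <;> simp
  · simp [unitFam]
  · simp [unitFam, eq_comm]
  · obtain ⟨i, j⟩ := p
    obtain ⟨k, l⟩ := q
    simp only [Aligned, ne_eq, Prod.mk.injEq, not_and, unitFam] at *
    grind

/-- The opposite coordinates. -/
def opFam (u : Fin N × Fin N → A) (p : Fin N × Fin N) : Aᵐᵒᵖ := MulOpposite.op (u p.swap)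

theorem Aligned.swap {p q : Fin N × Fin N} (h : Aligned p q) : Aligned p.swap q.swap :=
  ⟨fun h' => h.1 (Prod.swap_injective h'), h.2.symm⟩

theorem OrthRel.opFam (hu : OrthRel N A u) : OrthRel N Aᵐᵒᵖ (opFam u) := by
  refine ⟨fun p => congrArg MulOpposite.op (hu.1 _).star_eq, fun i j => ?_, fun i j => ?_⟩
  · refine MulOpposite.unop_injective ?_
    simp only [_root_.opFam, Prod.swap_prod_mk, Finset.unop_sum, MulOpposite.unop_mul,
      MulOpposite.unop_op, hu.2.2]
    split_ifs <;> simp_all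
  · refine MulOpposite.unop_injective ?_
    simp only [_root_.opFam, Prod.swap_prod_mk, Finset.unop_sum, MulOpposite.unop_mul,
      MulOpposite.unop_op, hu.2.1]
    split_ifs <;> simp_all

/-- Alignment is symmetric and stable under transposition, so the relation survives reversing
products and swapping indices. -/
theorem InftyRel.opFam (hu : InftyRel N A u) : InftyRel N Aᵐᵒᵖ (opFam u) :=
  ⟨hu.1.opFam, fun p q r h => MulOpposite.unop_injective <| by
    simpa [_root_.opFam, mul_assoc] using hu.2 _ q.swap _ h.symm.swap⟩

theorem StarRel.opFam (hu : StarRel N A u) : StarRel N Aᵐᵒᵖ (opFam u) :=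
  ⟨hu.1.opFam, fun p q h => MulOpposite.unop_injective <| by
    simpa [_root_.opFam] using hu.2.1 _ _ h.symm.swap,
    fun p q r => MulOpposite.unop_injective <| by
    simpa [_root_.opFam, mul_assoc] using hu.2.2 r.swap q.swap p.swap⟩

theorem ClassRel.opFam (hu : ClassRel N A u) : ClassRel N Aᵐᵒᵖ (opFam u) :=
  ⟨hu.1.opFam, fun p q h => MulOpposite.unop_injective <| by
    simpa [_root_.opFam] using hu.2.1 _ _ h.symm.swap,
    fun p q => MulOpposite.unop_injective <| by
    simpa [_root_.opFam] using hu.2.2 q.swap p.swap⟩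

/-- A space given by relations which are preserved by comultiplication, counit and antipode is a
quantum group. -/
theorem IsQuantumGroup.of_lift {G : NCSpace (Fin N × Fin N)} (hG : Generates G.coord)
    (R : FamilyClass (Fin N × Fin N))
    (hlift : ∀ (C : Type) [CStarAlgebra C] (v : Fin N × Fin N → C), R C v →
      ∃ φ : G.alg →⋆ₐ[ℂ] C, ∀ p, φ (G.coord p) = v p)
    (hO : OrthRel N G.alg G.coord) (hΔ : R _ (comulFam G.coord G.coord)) (hε : R ℂ (unitFam N))
    (hS : R _ (_root_.opFam G.coord)) : IsQuantumGroup G := by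
  refine ⟨?_, ?_, ?_, ?_⟩
  · obtain ⟨φ, hφ⟩ := exists_lift_univ hO hO.norm_le
    exact IsSubspace.of_hom hG φ hφ
  · obtain ⟨Δ, h⟩ := hlift _ _ hΔ
    exact ⟨Δ, fun i j => h (i, j)⟩
  · obtain ⟨ε, h⟩ := hlift _ _ hε
    exact ⟨ε, fun i j => h (i, j)⟩
  · obtain ⟨S, h⟩ := hlift _ _ hS
    exact ⟨S, fun i j => h (i, j)⟩

theorem HInfty.exists_lift (hu : InftyRel N A u) :
    ∃ φ : (HInfty N).alg →⋆ₐ[ℂ] A, ∀ p, φ ((HInfty N).coord p) = u p :=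
  exists_lift_univ hu hu.1.norm_le

theorem HStar.exists_lift (hu : StarRel N A u) :
    ∃ φ : (HStar N).alg →⋆ₐ[ℂ] A, ∀ p, φ ((HStar N).coord p) = u p :=
  exists_lift_univ hu hu.1.norm_le

theorem isQuantumGroup_HInfty : IsQuantumGroup (HInfty N) :=
  .of_lift (generates_univ _) (InftyRel N) (fun _ _ _ h => HInfty.exists_lift h) inftyRel_HInfty.1
    (inftyRel_HInfty.comul inftyRel_HInfty) classRel_unitFam.starRel.inftyRel inftyRel_HInfty.opFam

theorem isQuantumGroup_HStar : IsQuantumGroup (HStar N) :=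
  .of_lift (generates_univ _) (StarRel N) (fun _ _ _ h => HStar.exists_lift h) starRel_HStar.1
    (starRel_HStar.comul starRel_HStar) classRel_unitFam.starRel starRel_HStar.opFam

theorem HStar_isSubspace_HInfty : IsSubspace (HStar N) (HInfty N) := by
  obtain ⟨φ, hφ⟩ := HInfty.exists_lift (starRel_HStar (N := N)).inftyRel
  exact IsSubspace.of_hom (generates_univ _) φ hφ

end

/-! ### Commutative C*-algebras -/

/-- If the values at characters of a family in a commutative C*-algebra are coordinates of points
of a compact space `S`, there is a morphism from `C(S)`. -/
theorem exists_hom_of_characters {ι S D : Type} [TopologicalSpace S] [CompactSpace S] [T2Space S]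
    [CommCStarAlgebra D] (c : ι → C(S, ℂ)) (hc : Function.Injective fun s i => c i s) (f : ι → D)
    (h : ∀ χ : WeakDual.characterSpace ℂ D, ∃ s, ∀ i, χ (f i) = c i s) :
    ∃ φ : C(S, ℂ) →⋆ₐ[ℂ] D, ∀ i, φ (c i) = f i := by
  choose θ hθ using h
  have hemb : Topology.IsClosedEmbedding fun s i => c i s :=
    Continuous.isClosedEmbedding (by fun_prop) hc
  -- The coordinates embed `S` into a product, and composing `θ` with each of them gives a Gelfand
  -- transform, which is continuous.
  have hcont : Continuous θ := by
    rw [hemb.isInducing.continuous_iff]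
    refine continuous_pi fun i => ?_
    have : (fun χ => c i (θ χ)) = WeakDual.gelfandTransform ℂ D (f i) := by
      ext χ
      exact (hθ χ i).symm
    exact this ▸ map_continuous _
  refine ⟨((gelfandStarTransform D).symm : _ →⋆ₐ[ℂ] D).comp
    (ContinuousMap.compStarAlgHom' ℂ ℂ ⟨θ, hcont⟩), fun i => ?_⟩
  change (gelfandStarTransform D).symm _ = _
  rw [← StarAlgEquiv.symm_apply_apply (gelfandStarTransform D) (f i)]
  congr 1
  ext χ
  exact (hθ χ i).symm

/-- A character, as a morphism of C*-algebras. -/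
def characterHom {D : Type} [CommCStarAlgebra D] (χ : WeakDual.characterSpace ℂ D) : D →⋆ₐ[ℂ] ℂ :=
  { WeakDual.CharacterSpace.toAlgHom χ with map_star' := map_star χ }

/-- A commuting family of self-adjoint elements lives in a commutative C*-algebra. -/
theorem exists_commCStarAlgebra {ι C : Type} [CStarAlgebra C] {f : ι → C}
    (hsa : ∀ i, IsSelfAdjoint (f i)) (hcomm : ∀ i j, f i * f j = f j * f i) :
    ∃ (D : Type) (_ : CommCStarAlgebra D) (j : D →⋆ₐ[ℂ] C) (g : ι → D), Function.Injective j ∧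
      ∀ i, j (g i) = f i := by
  let E := (StarAlgebra.adjoin ℂ (Set.range f)).topologicalClosure
  have hcl : IsClosed (E : Set C) := StarSubalgebra.isClosed_topologicalClosure _
  have hcentralizer (s : Set C) : IsClosed (StarSubalgebra.centralizer ℂ s : Set C) := by
    rw [StarSubalgebra.coe_centralizer]
    exact Set.isClosed_centralizer _
  -- Commutativity of the closure is obtained in two passes: first against the generators, then,
  -- since the generators commute with all of `E`, against `E` itself.
  have h1 : E ≤ StarSubalgebra.centralizer ℂ (Set.range f) := by
    refine StarSubalgebra.topologicalClosure_minimal (StarAlgebra.adjoin_le ?_) (hcentralizer _)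
    rintro _ ⟨i, rfl⟩
    rw [SetLike.mem_coe, StarSubalgebra.mem_centralizer_iff]
    rintro _ ⟨j, rfl⟩
    rw [(hsa j).star_eq]
    exact ⟨hcomm j i, hcomm j i⟩
  have h2 : E ≤ StarSubalgebra.centralizer ℂ (E : Set C) := by
    refine StarSubalgebra.topologicalClosure_minimal (StarAlgebra.adjoin_le ?_) (hcentralizer _)
    rintro _ ⟨i, rfl⟩
    rw [SetLike.mem_coe, StarSubalgebra.mem_centralizer_iff]
    intro x hx
    have hx' := h1 (star_mem hx)
    replace hx := h1 hx
    rw [StarSubalgebra.mem_centralizer_iff] at hx hx'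
    exact ⟨(hx _ ⟨i, rfl⟩).1.symm, (hx' _ ⟨i, rfl⟩).1.symm⟩
  refine ⟨E, { (inferInstance : CStarAlgebra E) with
    mul_comm := fun a b => Subtype.ext ?_ }, E.subtype, fun i => ⟨f i, ?_⟩, ?_, fun i => rfl⟩
  · exact ((StarSubalgebra.mem_centralizer_iff ℂ).1 (h2 b.2) _ a.2).1
  · exact StarSubalgebra.le_topologicalClosure _ (StarAlgebra.subset_adjoin ℂ _ ⟨i, rfl⟩)
  · exact Subtype.val_injective

/-! ### The classical sphere and the group `H_N` as universal commutative objects. -/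

section

variable {N : ℕ} {A B : Type} [CStarAlgebra A] [CStarAlgebra B]

theorem FreeSphereRel.of_injective {x : Fin N → A} (φ : A →⋆ₐ[ℂ] B) (hφ : Function.Injective φ)
    (hx : FreeSphereRel N B fun i => φ (x i)) : FreeSphereRel N A x :=
  ⟨fun i => hφ (by rw [map_star]; exact hx.1 i), hφ (by simpa using hx.2)⟩

theorem ClassRel.of_injective {u : Fin N × Fin N → A} (φ : A →⋆ₐ[ℂ] B) (hφ : Function.Injective φ)
    (hu : ClassRel N B fun p => φ (u p)) : ClassRel N A u := by
  refine ⟨⟨fun p => hφ (by rw [map_star]; exact hu.1.1 p), fun i j => hφ ?_, fun i j => hφ ?_⟩,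
    fun p q h => hφ (by rw [map_mul, map_zero, hu.2.1 p q h]),
    fun p q => hφ (by rw [map_mul, map_mul, hu.2.2 p q])⟩
  · simp only [map_sum, map_mul, hu.1.2.1]; split_ifs <;> simp
  · simp only [map_sum, map_mul, hu.1.2.2]; split_ifs <;> simp

theorem ClassRel.map {u : Fin N × Fin N → A} (hu : ClassRel N A u) (φ : A →⋆ₐ[ℂ] B) :
    ClassRel N B fun p => φ (u p) :=
  ⟨hu.1.map φ, fun p q h => by simp only [← map_mul, hu.2.1 p q h, map_zero],
    fun p q => by simp only [← map_mul, hu.2.2 p q]⟩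

theorem realSphereRel_realSphere : RealSphereRel N (realSphere N).alg (realSphere N).coord := by
  let c : Fin N → C(Metric.sphere (0 : EuclideanSpace ℝ (Fin N)) 1, ℂ) := (realSphere N).coord
  suffices h : RealSphereRel N C(Metric.sphere (0 : EuclideanSpace ℝ (Fin N)) 1, ℂ) c from h
  refine ⟨⟨fun i => ContinuousMap.ext fun x => Complex.conj_ofReal _, ContinuousMap.ext fun x => ?_⟩,
    fun i j => mul_comm _ _⟩
  have h : ‖x.1‖ = 1 := mem_sphere_zero_iff_norm.1 x.2
  have h2 : ∑ i, (x.1 i) ^ 2 = 1 := by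
    rw [← EuclideanSpace.real_norm_sq_eq, h, one_pow]
  rw [ContinuousMap.coe_sum, Finset.sum_apply]
  change ∑ i, ((x.1 i : ℝ) : ℂ) ^ 2 = 1
  exact_mod_cast congrArg ((↑) : ℝ → ℂ) h2

theorem FreeSphereRel.exists_point {v : Fin N → ℂ} (hv : FreeSphereRel N ℂ v) :
    ∃ x : Metric.sphere (0 : EuclideanSpace ℝ (Fin N)) 1, ∀ i, v i = ((x.1 i : ℝ) : ℂ) := by
  have hre (i : Fin N) : (((v i).re : ℝ) : ℂ) = v i := Complex.conj_eq_iff_re.1 (hv.1 i)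
  refine ⟨⟨WithLp.toLp 2 fun i => (v i).re, ?_⟩, fun i => (hre i).symm⟩
  rw [mem_sphere_zero_iff_norm, ← sq_eq_sq₀ (norm_nonneg _) zero_le_one,
    EuclideanSpace.real_norm_sq_eq, one_pow]
  have h : ∑ i, (((v i).re : ℝ) : ℂ) ^ 2 = 1 := by rw [← hv.2]; simp_rw [hre]
  exact_mod_cast h

/-- The universal property of the algebra of functions on the usual sphere. -/
theorem realSphere.exists_lift {x : Fin N → A} (hx : RealSphereRel N A x) :
    ∃ φ : (realSphere N).alg →⋆ₐ[ℂ] A, ∀ i, φ ((realSphere N).coord i) = x i := by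
  obtain ⟨D, _, j, g, hj, hg⟩ := exists_commCStarAlgebra hx.1.1 hx.2
  have hrel : FreeSphereRel N D g := .of_injective j hj (by simpa only [hg] using hx.1)
  obtain ⟨φ, hφ⟩ := exists_hom_of_characters (D := D) (realSphere N).coord
    (fun s t h => Subtype.ext (PiLp.ext fun i => Complex.ofReal_injective (congrFun h i))) g
    fun χ => (hrel.map (characterHom χ)).exists_point
  exact ⟨j.comp φ, fun i => (congrArg j (hφ i)).trans (hg i)⟩

/-- Stone–Weierstrass: the coordinates separate points. -/
theorem generates_realSphere : Generates (realSphere N).coord := by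
  refine generates_of_adjoin
    (ContinuousMap.starSubalgebra_topologicalClosure_eq_top_of_separatesPoints _ ?_)
  intro x y hxy
  obtain ⟨i, hi⟩ : ∃ i, x.1 i ≠ y.1 i := by
    by_contra! h
    exact hxy (Subtype.ext (PiLp.ext h))
  exact ⟨_, ⟨(realSphere N).coord i, StarAlgebra.subset_adjoin ℂ _ ⟨i, rfl⟩, rfl⟩,
    fun h => hi (Complex.ofReal_injective h)⟩

variable (N) in
/-- The group `H_N`. -/
abbrev HypGroup : Type := (Fin N → ℤˣ) × Equiv.Perm (Fin N)

theorem classRel_HClassical : ClassRel N (HClassical N).alg (HClassical N).coord := by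
  have hsq (z : ℤˣ) : ((z : ℤ) : ℂ) * ((z : ℤ) : ℂ) = 1 := by
    rcases Int.units_eq_one_or z with rfl | rfl <;> simp
  let c : Fin N × Fin N → (HypGroup N → ℂ) := (HClassical N).coord
  suffices h : ClassRel N (HypGroup N → ℂ) c from h
  refine ⟨⟨fun p => funext fun h => ?_, fun i j => funext fun h => ?_,
    fun i j => funext fun h => ?_⟩, fun p q hpq => funext fun h => ?_,
    fun p q => mul_comm _ _⟩
  · change star (if _ then _ else _) = _
    split_ifs with h' <;> simp [c, HClassical, h']
  · rw [Finset.sum_apply]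
    change ∑ k, (if i = h.2 k then (((h.1 i : ℤˣ) : ℤ) : ℂ) else 0) *
      (if j = h.2 k then (((h.1 j : ℤˣ) : ℤ) : ℂ) else 0) = _
    rw [← Equiv.sum_comp h.2.symm]
    simp only [Equiv.apply_symm_apply]
    by_cases hij : i = j
    · subst hij; simp [hsq]
    · simp [hij]
  · rw [Finset.sum_apply]
    change ∑ k, (if k = h.2 i then (((h.1 k : ℤˣ) : ℤ) : ℂ) else 0) *
      (if k = h.2 j then (((h.1 k : ℤˣ) : ℤ) : ℂ) else 0) = _
    by_cases hij : i = j
    · subst hij; simp [hsq]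
    · simp [hij, Ne.symm hij]
  · change (if p.1 = h.2 p.2 then (((h.1 p.1 : ℤˣ) : ℤ) : ℂ) else 0) *
      (if q.1 = h.2 q.2 then (((h.1 q.1 : ℤˣ) : ℤ) : ℂ) else 0) = 0
    obtain ⟨i, j⟩ := p
    obtain ⟨k, l⟩ := q
    obtain ⟨h1, h2⟩ := hpq
    have := h.2.injective.eq_iff (a := j) (b := l)
    simp only [ne_eq, Prod.mk.injEq, not_and] at *
    grind

/-- Orthogonality forces a nonzero entry in each column, and vanishing of aligned products makes it
the only one in its row and column, with square one. Hence the characters of this presentation are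
the signed permutation matrices. -/
theorem ClassRel.exists_point {v : Fin N × Fin N → ℂ} (hv : ClassRel N ℂ v) :
    ∃ h : (Fin N → ℤˣ) × Equiv.Perm (Fin N), ∀ p, v p = (HClassical N).coord p h := by
  have hcol (j : Fin N) : ∃ i, v (i, j) ≠ 0 := by
    by_contra! h
    have := hv.1.2.2 j j
    simp [h] at this
  choose σ hσ using hcol
  have hzero {p q : Fin N × Fin N} (h : Aligned p q) (hp : v p ≠ 0) : v q = 0 :=
    (mul_eq_zero.1 (hv.2.1 p q h)).resolve_left hp
  have hinj : Function.Injective σ := fun j j' h => by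
    by_contra hne
    exact hσ j' (hzero (p := (σ j, j)) ⟨fun h' => hne (congrArg Prod.snd h'), Or.inl h⟩ (hσ j))
  have hother {i j : Fin N} (h : i ≠ σ j) : v (i, j) = 0 :=
    hzero (p := (σ j, j)) ⟨fun h' => h (congrArg Prod.fst h').symm, Or.inr rfl⟩ (hσ j)
  have hone (j : Fin N) : v (σ j, j) = 1 ∨ v (σ j, j) = -1 := by
    have := hv.1.2.2 j j
    rw [if_pos rfl, Finset.sum_eq_single_of_mem (σ j) (Finset.mem_univ _)
      fun i _ hi => by rw [hother hi, zero_mul]] at this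
    exact mul_self_eq_one_iff.1 this
  let τ := Equiv.ofBijective σ (Finite.injective_iff_bijective.1 hinj)
  -- The signs are indexed by rows, so the entry of row `i` is read in column `τ⁻¹ i`.
  refine ⟨(fun i => if v (i, τ.symm i) = 1 then 1 else -1, τ), fun p => ?_⟩
  obtain ⟨i, j⟩ := p
  change v (i, j) = if i = τ j then _ else _
  split_ifs with h
  · subst h
    simp only [Equiv.symm_apply_apply]
    change v (σ j, j) = (((if v (σ j, j) = 1 then 1 else -1 : ℤˣ) : ℤ) : ℂ)
    rcases hone j with h | h
    · simp [h]
    · rw [h, if_neg (by norm_num)]; simp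
  · exact hother h

theorem coord_HClassical_injective :
    Function.Injective fun (h : HypGroup N) p => (HClassical N).coord p h := by
  rintro ⟨ε, σ⟩ ⟨ε', σ'⟩ h
  have hne (z : ℤˣ) : ((z : ℤ) : ℂ) ≠ 0 := by exact_mod_cast z.ne_zero
  have hσ : σ = σ' := by
    ext j
    have := congrFun h (σ j, j)
    by_contra hne'
    simp [HClassical, hne, Fin.ext_iff, hne'] at this
  subst hσ
  have hε : ε = ε' := by
    ext i
    have := congrFun h (i, σ.symm i)
    simpa [HClassical] using this
  rw [hε]

/-- The universal property of the algebra of functions on `H_N`. -/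
theorem HClassical.exists_lift {u : Fin N × Fin N → A} (hu : ClassRel N A u) :
    ∃ φ : (HClassical N).alg →⋆ₐ[ℂ] A, ∀ p, φ ((HClassical N).coord p) = u p := by
  obtain ⟨D, _, j, g, hj, hg⟩ := exists_commCStarAlgebra hu.1.1 hu.2.2
  have hrel : ClassRel N D g := .of_injective j hj (by simpa only [hg] using hu)
  -- With the discrete topology all functions on this finite group are continuous, so Gelfand
  -- duality applies.
  let _ : TopologicalSpace (HypGroup N) := ⊥
  have : DiscreteTopology (HypGroup N) := ⟨rfl⟩
  obtain ⟨φ, hφ⟩ := exists_hom_of_characters (D := D)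
    (fun p => (⟨(HClassical N).coord p, continuous_of_discreteTopology⟩ : C(HypGroup N, ℂ)))
    coord_HClassical_injective g
    fun χ => (hrel.map (characterHom χ)).exists_point
  let ψ : (HypGroup N → ℂ) →⋆ₐ[ℂ] C(HypGroup N, ℂ) :=
    { toFun := fun f => ⟨f, continuous_of_discreteTopology⟩
      map_one' := rfl
      map_mul' := fun _ _ => rfl
      map_zero' := rfl
      map_add' := fun _ _ => rfl
      commutes' := fun _ => rfl
      map_star' := fun _ => rfl }
  exact ⟨(j.comp φ).comp ψ, fun i => (congrArg j (hφ i)).trans (hg i)⟩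

theorem generates_HClassical : Generates (HClassical N).coord := by
  let _ : TopologicalSpace (HypGroup N) := ⊥
  have : DiscreteTopology (HypGroup N) := ⟨rfl⟩
  let c (p : Fin N × Fin N) : C(HypGroup N, ℂ) :=
    ⟨(HClassical N).coord p, continuous_of_discreteTopology⟩
  have hc : Generates c := by
    refine generates_of_adjoin
      (ContinuousMap.starSubalgebra_topologicalClosure_eq_top_of_separatesPoints _ ?_)
    intro x y hxy
    obtain ⟨p, hp⟩ : ∃ p, (HClassical N).coord p x ≠ (HClassical N).coord p y := by
      by_contra! h
      exact hxy (coord_HClassical_injective (funext h))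
    exact ⟨_, ⟨c p, StarAlgebra.subset_adjoin ℂ _ ⟨p, rfl⟩, rfl⟩, hp⟩
  let ψ : C(HypGroup N, ℂ) →⋆ₐ[ℂ] (HypGroup N → ℂ) :=
    { toFun := fun f => f
      map_one' := rfl
      map_mul' := fun _ _ => rfl
      map_zero' := rfl
      map_add' := fun _ _ => rfl
      commutes' := fun _ => rfl
      map_star' := fun _ => rfl }
  exact hc.map ψ (Function.Surjective.denseRange fun f => ⟨⟨f, continuous_of_discreteTopology⟩, rfl⟩)

theorem isQuantumGroup_HClassical : IsQuantumGroup (HClassical N) :=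
  .of_lift generates_HClassical (ClassRel N) (fun _ _ _ h => HClassical.exists_lift h)
    classRel_HClassical.1 (classRel_HClassical.comul classRel_HClassical) classRel_unitFam
    classRel_HClassical.opFam

theorem HClassical_isSubspace_HStar : IsSubspace (HClassical N) (HStar N) := by
  obtain ⟨φ, hφ⟩ := HStar.exists_lift (classRel_HClassical (N := N)).starRel
  exact IsSubspace.of_hom generates_HClassical φ hφ

end

/-! ### Group C*-algebras -/

section GroupAlgebra

variable {Γ : Type} [Group Γ] {C : Type} [CStarAlgebra C]

variable (Γ) in
/-- The canonical unitary representation. -/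
def groupUnit : Γ →* GroupCStar Γ where
  toFun γ := gen _ _ γ
  map_one' := ext_ev fun p => by
    obtain ⟨φ, hφ⟩ := family_mem p
    simp [hφ]
  map_mul' γ δ := ext_ev fun p => by
    obtain ⟨φ, hφ⟩ := family_mem p
    simp [hφ]

theorem star_groupUnit (γ : Γ) : star (groupUnit Γ γ) = groupUnit Γ γ⁻¹ :=
  ext_ev fun p => by
    obtain ⟨φ, hφ⟩ := family_mem p
    simp only [groupUnit, MonoidHom.coe_mk, OneHom.coe_mk, map_star, ev_gen, hφ, map_inv]
    rfl

theorem generates_groupUnit : Generates (groupUnit Γ) := generates_gen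

theorem exists_lift_group (φ : Γ →* unitary C) :
    ∃ Φ : GroupCStar Γ →⋆ₐ[ℂ] C, ∀ γ, Φ (groupUnit Γ γ) = φ γ := by
  refine exists_lift (b := fun _ => 1) ⟨φ, fun _ => rfl⟩ fun γ => ?_
  rcases subsingleton_or_nontrivial C with _ | _
  · rw [Subsingleton.elim ((φ γ : C)) 0, norm_zero]; exact zero_le_one
  · exact (CStarRing.norm_coe_unitary (φ γ)).le

/-- The permutation representation of a finite action. -/
theorem exists_permRep {S : Type} [Fintype S] [DecidableEq S] (σ : Γ →* Equiv.Perm S) :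
    ∃ ρ : GroupCStar Γ →⋆ₐ[ℂ] (EuclideanSpace ℂ S →L[ℂ] EuclideanSpace ℂ S), ∀ γ s,
      ρ (groupUnit Γ γ) (EuclideanSpace.single s 1) = EuclideanSpace.single (σ γ s) 1 := by
  let φ : Γ →* (EuclideanSpace ℂ S ≃ₗᵢ[ℂ] EuclideanSpace ℂ S) :=
    { toFun := fun γ => LinearIsometryEquiv.piLpCongrLeft 2 ℂ ℂ (σ γ)
      map_one' := by ext; simp [LinearIsometryEquiv.piLpCongrLeft_apply]; rfl
      map_mul' := fun γ δ => by
        ext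
        simp [LinearIsometryEquiv.piLpCongrLeft_apply, Equiv.piCongrLeft']
        rfl }
  obtain ⟨ρ, hρ⟩ := exists_lift_group (Unitary.linearIsometryEquiv.symm.toMonoidHom.comp φ)
  refine ⟨ρ, fun γ s => ?_⟩
  rw [hρ]
  exact EuclideanSpace.piLpCongrLeft_single (σ γ) s 1

/-- The coefficient of `γ` between `δ_v` and `δ_w` in a permutation representation is one if `γ v =
w` and zero otherwise, so slicing by it sums the `a i` whose group element carries `v` to `w`.
Finite actions suffice to isolate the coefficients needed later. -/
theorem sum_ite_eq_zero_of_tensor {A ι S : Type} [CStarAlgebra A] [Fintype S] [DecidableEq S]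
    {s : Finset ι} {a : ι → A} {γ : ι → Γ} (h : ∑ i ∈ s, ctmul (a i) (groupUnit Γ (γ i)) = 0)
    (σ : Γ →* Equiv.Perm S) (v w : S) :
    ∑ i ∈ s, (if σ (γ i) v = w then a i else 0) = 0 := by
  obtain ⟨ρ, hρ⟩ := exists_permRep σ
  refine (Finset.sum_congr rfl fun i _ => ?_).trans
    (sum_slice_eq_zero h ρ (EuclideanSpace.single v 1) (EuclideanSpace.single w 1))
  rw [hρ, EuclideanSpace.inner_single_left]
  by_cases h : σ (γ i) v = w
  · simp [h]
  · simp [h, Ne.symm h]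

end GroupAlgebra

/-! ### Reflection groups -/

section Reflection

variable {N : ℕ} {G : Type} [Group G]

theorem z2_cases (z : Z2) : z = 1 ∨ z = z2gen := by
  revert z
  change ∀ z : ZMod 2, z = 0 ∨ z = 1
  decide

theorem z2gen_mul_self : z2gen * z2gen = 1 := by
  change (1 + 1 : ZMod 2) = 0
  decide

theorem z2gen_ne_one : z2gen ≠ 1 := by
  change (1 : ZMod 2) ≠ 0
  decide

/-- The morphism from `ℤ_2` given by an involution. -/
def z2Lift (h : G) (hh : h * h = 1) : Z2 →* G where
  toFun z := if z = 1 then 1 else h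
  map_one' := if_pos rfl
  map_mul' z w := by
    rcases z2_cases z with rfl | rfl <;> rcases z2_cases w with rfl | rfl <;>
      simp [z2gen_ne_one, z2gen_mul_self, hh]

@[simp]
theorem z2Lift_z2gen (h : G) (hh : h * h = 1) : z2Lift h hh z2gen = h :=
  show (if z2gen = 1 then 1 else h) = h from if_neg z2gen_ne_one

theorem freeGen_mul_self (i : Fin N) : freeGen N i * freeGen N i = 1 := by
  rw [freeGen, ← map_mul, z2gen_mul_self, map_one]

theorem halfGen_mul_self (i : Fin N) : halfGen N i * halfGen N i = 1 := by
  rw [halfGen, ← QuotientGroup.mk_mul, freeGen_mul_self, QuotientGroup.mk_one]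

theorem powGen_mul_self (i : Fin N) : powGen N i * powGen N i = 1 := by
  rw [powGen, ← Pi.mulSingle_mul, z2gen_mul_self, Pi.mulSingle_one]

theorem halfGen_half (i j k : Fin N) :
    halfGen N i * halfGen N j * halfGen N k = halfGen N k * halfGen N j * halfGen N i := by
  rw [← mul_inv_eq_one]
  exact (QuotientGroup.eq_one_iff _).2 (Subgroup.subset_normalClosure ⟨i, j, k, rfl⟩)

theorem powGen_comm (i j : Fin N) : powGen N i * powGen N j = powGen N j * powGen N i :=
  mul_comm _ _

theorem exists_freeLift (h : Fin N → G) (hh : ∀ i, h i * h i = 1) :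
    ∃ φ : FreeRefl N →* G, ∀ i, φ (freeGen N i) = h i :=
  ⟨Monoid.CoprodI.lift fun i => z2Lift (h i) (hh i), fun i => by
    rw [freeGen, Monoid.CoprodI.lift_of, z2Lift_z2gen]⟩

theorem exists_halfLift (h : Fin N → G) (hh : ∀ i, h i * h i = 1)
    (hc : ∀ i j k, h i * h j * h k = h k * h j * h i) :
    ∃ φ : HalfRefl N →* G, ∀ i, φ (halfGen N i) = h i := by
  obtain ⟨φ, hφ⟩ := exists_freeLift h hh
  refine ⟨QuotientGroup.lift _ φ ?_, fun i => (QuotientGroup.lift_mk _ _ _).trans (hφ i)⟩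
  refine Subgroup.normalClosure_le_normal ?_
  rintro _ ⟨i, j, k, rfl⟩
  rw [SetLike.mem_coe, MonoidHom.mem_ker]
  simp only [map_mul, map_inv, hφ, hc i j k, mul_inv_cancel]

theorem exists_powLift (h : Fin N → G) (hh : ∀ i, h i * h i = 1)
    (hc : ∀ i j, h i * h j = h j * h i) :
    ∃ φ : (Fin N → Z2) →* G, ∀ i, φ (powGen N i) = h i := by
  have hcomm : Pairwise fun i j => ∀ x y, Commute (z2Lift (h i) (hh i) x) (z2Lift (h j) (hh j) y) := by
    intro i j _ x y
    rcases z2_cases x with rfl | rfl <;> rcases z2_cases y with rfl | rfl <;> simp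
    exact hc i j
  refine ⟨MonoidHom.noncommPiCoprod (fun i => z2Lift (h i) (hh i)) hcomm, fun i => ?_⟩
  · rw [powGen, MonoidHom.noncommPiCoprod_mulSingle, z2Lift_z2gen]

theorem closure_freeGen : Subgroup.closure (Set.range (freeGen N)) = ⊤ := by
  refine eq_top_iff.2 fun x _ => ?_
  induction x using Monoid.CoprodI.induction_on with
  | one => exact one_mem _
  | of i z =>
    rcases z2_cases z with rfl | rfl
    · rw [map_one]; exact one_mem _
    · exact Subgroup.subset_closure ⟨i, rfl⟩
  | mul x y hx hy => exact mul_mem (hx trivial) (hy trivial)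

theorem closure_halfGen : Subgroup.closure (Set.range (halfGen N)) = ⊤ := by
  have h := congrArg (Subgroup.map (QuotientGroup.mk' (Subgroup.normalClosure {w : FreeRefl N |
    ∃ i j k, w = freeGen N i * freeGen N j * freeGen N k *
      (freeGen N k * freeGen N j * freeGen N i)⁻¹}))) (closure_freeGen (N := N))
  rw [MonoidHom.map_closure, ← Set.range_comp, Subgroup.map_top_of_surjective _
    (QuotientGroup.mk'_surjective _)] at h
  exact h

theorem closure_powGen : Subgroup.closure (Set.range (powGen N)) = ⊤ := by
  refine eq_top_iff.2 fun x _ => ?_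
  rw [← Finset.univ_prod_mulSingle x]
  refine prod_mem fun i _ => ?_
  rcases z2_cases (x i) with h | h
  · rw [h, Pi.mulSingle_one]; exact one_mem _
  · rw [h]; exact Subgroup.subset_closure ⟨i, rfl⟩

end Reflection

/-! ### Cubes -/

section Cube

variable {N : ℕ} {A B : Type} [CStarAlgebra A] [CStarAlgebra B]

variable (N) in
/-- The relations of the free cube. -/
def CubeRel : FamilyClass (Fin N) := fun _ _ x =>
  (∀ i, IsSelfAdjoint (x i)) ∧ ∀ i, x i * x i = (N : ℂ)⁻¹ • 1

variable (N) in
/-- The normalization factor of the coordinates of cubes. -/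
def cubeScale : ℂ := ((Real.sqrt N : ℝ) : ℂ)⁻¹

theorem cubeScale_mul_self : cubeScale N * cubeScale N = (N : ℂ)⁻¹ := by
  rw [cubeScale, ← mul_inv, ← Complex.ofReal_mul, Real.mul_self_sqrt (Nat.cast_nonneg N),
    Complex.ofReal_natCast]

theorem star_cubeScale : star (cubeScale N) = cubeScale N := by
  rw [cubeScale, star_inv₀]
  exact congrArg _ (Complex.conj_ofReal _)

theorem natCast_ne_zero_of_fin (i : Fin N) : (N : ℂ) ≠ 0 :=
  Nat.cast_ne_zero.2 (Nat.pos_iff_ne_zero.1 i.pos)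

theorem cubeScale_ne_zero (i : Fin N) : cubeScale N ≠ 0 := fun h =>
  inv_ne_zero (natCast_ne_zero_of_fin i) (by rw [← cubeScale_mul_self, h, mul_zero])

/-- The `N` squares `1/N` add up to one, which needs `N` nonzero. -/
theorem CubeRel.freeSphereRel (hN : 1 ≤ N) {x : Fin N → A} (hx : CubeRel N A x) :
    FreeSphereRel N A x := by
  refine ⟨hx.1, ?_⟩
  simp only [sq, hx.2]
  rw [Finset.sum_const, Finset.card_univ, Fintype.card_fin, ← Nat.cast_smul_eq_nsmul ℂ, smul_smul,
    mul_inv_cancel₀ (Nat.cast_ne_zero.2 (by omega)), one_smul]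

theorem CubeRel.inftySphereRel (hN : 1 ≤ N) {x : Fin N → A} (hx : CubeRel N A x) :
    InftySphereRel N A x :=
  ⟨hx.freeSphereRel hN, fun i j => by simp [sq, hx.2]⟩

/-- Aligned products vanish, so the square is `∑_a u_ia^2 ⊗ 1/N`, and row orthogonality sums the
first legs to one. -/
theorem CubeRel.tact {u : Fin N × Fin N → A} {x : Fin N → B} (hu : InftyRel N A u)
    (hx : CubeRel N B x) : CubeRel N (CTensor A B) (tact u x) := by
  refine ⟨tact_selfAdjoint hu.1.1 hx.1, fun i => ?_⟩
  rw [tact_mul_self fun p q h => hu.mul_eq_zero h]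
  simp only [hx.2, ctmul_smul_right, ← Finset.smul_sum, ← ctmul_sum_left, hu.1.2.1, if_pos,
    ctmul_one_one]

section

variable {Γ : Type} [Group Γ] {g : Fin N → Γ}

theorem cubeRel_cube (hg : ∀ i, g i * g i = 1) : CubeRel N (cube g).alg (cube g).coord := by
  let c : Fin N → GroupCStar Γ := fun i => cubeScale N • groupUnit Γ (g i)
  suffices h : CubeRel N (GroupCStar Γ) c from h
  refine ⟨fun i => ?_, fun i => ?_⟩
  · rw [isSelfAdjoint_iff, star_smul, star_cubeScale, star_groupUnit, inv_eq_of_mul_eq_one_left (hg i)]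
  · rw [smul_mul_smul_comm, cubeScale_mul_self, ← map_mul, hg, map_one]

theorem generates_cube (h : Subgroup.closure (Set.range g) = ⊤) : Generates (cube g).coord := by
  let c : Fin N → GroupCStar Γ := fun i => cubeScale N • groupUnit Γ (g i)
  suffices h : Generates c from h
  refine generates_of_adjoin (eq_top_iff.2 fun a _ => ?_)
  refine generates_groupUnit.mem (StarSubalgebra.isClosed_topologicalClosure _) (fun γ => ?_) a
  have hγ : γ ∈ Subgroup.closure (Set.range g) := h ▸ Subgroup.mem_top γ
  induction hγ using Subgroup.closure_induction with
  | mem x hx =>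
    obtain ⟨i, rfl⟩ := hx
    have h1 : groupUnit Γ (g i) = (cubeScale N)⁻¹ • c i := by
      rw [smul_smul, inv_mul_cancel₀ (cubeScale_ne_zero i), one_smul]
    rw [h1]
    exact SMulMemClass.smul_mem _
      (StarSubalgebra.le_topologicalClosure _ (StarAlgebra.subset_adjoin ℂ _ ⟨i, rfl⟩))
  | one => rw [map_one]; exact one_mem _
  | mul x y _ _ hx hy => rw [map_mul]; exact mul_mem hx hy
  | inv x _ hx => rw [← star_groupUnit]; exact star_mem hx

theorem exists_lift_cube {x : Fin N → A} (φ : Γ →* unitary A)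
    (h : ∀ i, x i = cubeScale N • (φ (g i) : A)) :
    ∃ Φ : (cube g).alg →⋆ₐ[ℂ] A, ∀ i, Φ ((cube g).coord i) = x i := by
  obtain ⟨Φ, hΦ⟩ := exists_lift_group φ
  exact ⟨Φ, fun i => (map_smul Φ (cubeScale N) (groupUnit Γ (g i))).trans (by rw [hΦ, h])⟩

theorem cube_isSubspace_cube {Γ' : Type} [Group Γ'] {g' : Fin N → Γ'}
    (h : Subgroup.closure (Set.range g') = ⊤) (φ : Γ →* Γ') (hφ : ∀ i, φ (g i) = g' i) :
    IsSubspace (cube g') (cube g) := by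
  let ψ : Γ' →* unitary (GroupCStar Γ') :=
    { toFun := fun γ => ⟨groupUnit Γ' γ, by
        rw [Unitary.mem_iff, star_groupUnit, ← map_mul, ← map_mul]; simp⟩
      map_one' := Subtype.ext (map_one _)
      map_mul' := fun _ _ => Subtype.ext (map_mul _ _ _) }
  obtain ⟨Φ, hΦ⟩ := exists_lift_cube (g := g) (x := (cube g').coord) (ψ.comp φ) fun i =>
    congrArg (fun γ => cubeScale N • groupUnit Γ' γ) (hφ i).symm
  exact IsSubspace.of_hom (generates_cube h) Φ hΦ

end

/-- The symmetries attached to the coordinates of a cube. -/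
theorem CubeRel.exists_unitary {x : Fin N → A} (hx : CubeRel N A x) :
    ∃ h : Fin N → unitary A, (∀ i, h i * h i = 1) ∧ (∀ i, (h i : A) = (cubeScale N)⁻¹ • x i) ∧
      ∀ i, x i = cubeScale N • (h i : A) := by
  have hsq (i : Fin N) : ((cubeScale N)⁻¹ • x i) * ((cubeScale N)⁻¹ • x i) = 1 := by
    rw [smul_mul_smul_comm, hx.2, smul_smul, ← mul_inv, cubeScale_mul_self, inv_inv,
      mul_inv_cancel₀ (natCast_ne_zero_of_fin i), one_smul]
  have hsa (i : Fin N) : star ((cubeScale N)⁻¹ • x i) = (cubeScale N)⁻¹ • x i := by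
    rw [star_smul, star_inv₀, star_cubeScale, (hx.1 i).star_eq]
  exact ⟨fun i => ⟨(cubeScale N)⁻¹ • x i, by rw [Unitary.mem_iff, hsa, hsq]; simp⟩,
    fun i => Subtype.ext (hsq i), fun i => rfl,
    fun i => by rw [smul_smul, mul_inv_cancel₀ (cubeScale_ne_zero i), one_smul]⟩

theorem freeCube.exists_lift {x : Fin N → A} (hx : CubeRel N A x) :
    ∃ Φ : (cube (freeGen N)).alg →⋆ₐ[ℂ] A, ∀ i, Φ ((cube (freeGen N)).coord i) = x i := by
  obtain ⟨h, h1, -, h3⟩ := hx.exists_unitary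
  obtain ⟨φ, hφ⟩ := exists_freeLift h h1
  exact exists_lift_cube φ fun i => by rw [hφ, h3]

theorem halfCube.exists_lift {x : Fin N → A} (hx : CubeRel N A x)
    (hc : ∀ i j k, x i * x j * x k = x k * x j * x i) :
    ∃ Φ : (cube (halfGen N)).alg →⋆ₐ[ℂ] A, ∀ i, Φ ((cube (halfGen N)).coord i) = x i := by
  obtain ⟨h, h1, h2, h3⟩ := hx.exists_unitary
  obtain ⟨φ, hφ⟩ := exists_halfLift h h1 fun i j k => Subtype.ext (by
    simp only [Submonoid.coe_mul, h2, smul_mul_smul_comm, hc i j k])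
  exact exists_lift_cube φ fun i => by rw [hφ, h3]

theorem powCube.exists_lift {x : Fin N → A} (hx : CubeRel N A x)
    (hc : ∀ i j, x i * x j = x j * x i) :
    ∃ Φ : (cube (powGen N)).alg →⋆ₐ[ℂ] A, ∀ i, Φ ((cube (powGen N)).coord i) = x i := by
  obtain ⟨h, h1, h2, h3⟩ := hx.exists_unitary
  obtain ⟨φ, hφ⟩ := exists_powLift h h1 fun i j => Subtype.ext (by
    simp only [Submonoid.coe_mul, h2, smul_mul_smul_comm, hc i j])
  exact exists_lift_cube φ fun i => by rw [hφ, h3]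

theorem halfCube_half (i j k : Fin N) : (cube (halfGen N)).coord i * (cube (halfGen N)).coord j *
    (cube (halfGen N)).coord k = (cube (halfGen N)).coord k * (cube (halfGen N)).coord j *
      (cube (halfGen N)).coord i := by
  let c (i : Fin N) : GroupCStar (HalfRefl N) := cubeScale N • groupUnit _ (halfGen N i)
  change c i * c j * c k = c k * c j * c i
  simp only [c, smul_mul_smul_comm, ← map_mul, halfGen_half i j k]

theorem powCube_comm (i j : Fin N) : (cube (powGen N)).coord i * (cube (powGen N)).coord j =
    (cube (powGen N)).coord j * (cube (powGen N)).coord i := by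
  let c (i : Fin N) : GroupCStar (Fin N → Z2) := cubeScale N • groupUnit _ (powGen N i)
  change c i * c j = c j * c i
  simp only [c, smul_mul_smul_comm, ← map_mul, powGen_comm i j]

end Cube

/-! ### Maximality -/

section Maximality

variable {N : ℕ} {A : Type} [CStarAlgebra A] {u : Fin N × Fin N → A}

/-- Reading off components `a` and `b` recovers the unordered pair of generators; a repeated
generator would give the unit. -/
theorem powGen_mul_powGen_eq_iff {a b c d : Fin N} (h : a ≠ b) :
    powGen N c * powGen N d = powGen N a * powGen N b ↔ (c, d) = (a, b) ∨ (c, d) = (b, a) := by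
  constructor
  · intro h'
    have ha := congrFun h' a
    have hb := congrFun h' b
    have h1 := z2gen_ne_one
    have h2 := z2gen_mul_self
    simp only [powGen, Pi.mul_apply, Pi.mulSingle_apply] at ha hb
    simp only [Prod.mk.injEq]
    grind
  · rintro (h | h) <;> obtain ⟨rfl, rfl⟩ := Prod.mk.inj h
    · rfl
    · exact powGen_comm _ _

/-- The left side is `e_d - e_e + e_f`. Modulo 3 the signs distinguish the middle index from the
outer two, which modulo 2 they would not, and the set acted upon stays finite, as the permutation
representation requires. -/
theorem single_sub_eq_iff {a b c d e f : Fin N} (hab : a ≠ b) (hac : a ≠ c) (hbc : b ≠ c) :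
    (Pi.single d 1 - (Pi.single e 1 - (Pi.single f 1 - 0)) : Fin N → ZMod 3) =
      Pi.single a 1 - (Pi.single b 1 - (Pi.single c 1 - 0)) ↔
    (d, e, f) = (a, b, c) ∨ (d, e, f) = (c, b, a) := by
  constructor
  · intro h'
    have key (i : Fin N) := congrFun h' i
    simp only [Pi.sub_apply, Pi.single_apply, Pi.zero_apply] at key
    have ha := key a
    have hb := key b
    have hc := key c
    have h1 : (1 : ZMod 3) ≠ 0 := by decide
    have h2 : (1 : ZMod 3) + 1 ≠ 0 := by decide
    have h3 : (1 : ZMod 3) + 1 + 1 = 0 := by decide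
    simp only [Prod.mk.injEq]
    grind
  · rintro (h | h) <;> simp only [Prod.mk.injEq] at h <;> obtain ⟨rfl, rfl, rfl⟩ := h
    · rfl
    · abel

/-- If the affine action formula defines commuting elements over the usual cube, the coordinates
commute. -/
theorem InftyRel.classRel_of_tact (hu : InftyRel N A u)
    (h : ∀ i j, tact u (cube (powGen N)).coord i * tact u (cube (powGen N)).coord j =
      tact u (cube (powGen N)).coord j * tact u (cube (powGen N)).coord i) : ClassRel N A u := by
  refine ⟨hu.1, fun p q hp => hu.mul_eq_zero hp, ?_⟩
  rintro ⟨i, a⟩ ⟨j, b⟩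
  by_cases hij : i = j
  · by_cases hab : a = b
    · rw [hij, hab]
    · rw [hu.mul_eq_zero (p := (i, a)) (q := (j, b)) ⟨by simp [hab], Or.inl hij⟩,
        hu.mul_eq_zero (p := (j, b)) (q := (i, a)) ⟨by simp [Ne.symm hab], Or.inl hij.symm⟩]
  by_cases hab : a = b
  · rw [hu.mul_eq_zero (p := (i, a)) (q := (j, b)) ⟨by simp [hij], Or.inr hab⟩,
      hu.mul_eq_zero (p := (j, b)) (q := (i, a)) ⟨by simp [Ne.symm hij], Or.inr hab.symm⟩]
  let x (i : Fin N) : GroupCStar (Fin N → Z2) := cubeScale N • groupUnit _ (powGen N i)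
  have h0 : tact u x i * tact u x j - tact u x j * tact u x i = 0 := sub_eq_zero.2 (h i j)
  rw [tact_mul, tact_mul, ← Fintype.sum_prod_type', ← Fintype.sum_prod_type',
    ← Finset.sum_sub_distrib] at h0
  have hcoord (c d : Fin N) : x c * x d =
      (cubeScale N * cubeScale N) • groupUnit (Fin N → Z2) (powGen N c * powGen N d) := by
    rw [map_mul, ← smul_mul_smul_comm]
  simp only [hcoord, ctmul_smul_right, ← smul_sub, ← ctmul_sub_left] at h0
  rw [← Finset.smul_sum, smul_eq_zero_iff_right (mul_ne_zero (cubeScale_ne_zero i)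
    (cubeScale_ne_zero i))] at h0
  -- The translation action sends `1` to `g_a g_b` only under the element `g_a g_b`; it arises from
  -- the index pairs `(a, b)` and `(b, a)`.
  have h1 := sum_ite_eq_zero_of_tensor h0 (MulAction.toPermHom (Fin N → Z2) (Fin N → Z2)) 1
    (powGen N a * powGen N b)
  simp only [MulAction.toPermHom_apply, MulAction.toPerm_apply, smul_eq_mul, mul_one,
    powGen_mul_powGen_eq_iff hab, Prod.mk.eta] at h1
  rw [← Finset.sum_filter, Finset.filter_or, Finset.filter_eq', Finset.filter_eq',
    if_pos (Finset.mem_univ _), if_pos (Finset.mem_univ _),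
    show ({(a, b)} ∪ {(b, a)} : Finset (Fin N × Fin N)) = {(a, b), (b, a)} from rfl,
    Finset.sum_pair (by simp [hab])] at h1
  -- The central projection `u_ia^2` fixes the two products containing `u_ia` and kills those
  -- containing `u_ib` and `u_ja`, which are aligned with it.
  have h2 := congrArg (u (i, a) * u (i, a) * ·) h1
  have e1 : u (i, a) * u (i, a) * (u (i, a) * u (j, b)) = u (i, a) * u (j, b) := by
    rw [← mul_assoc, hu.cube_eq]
  have e2 : u (i, a) * u (i, a) * (u (j, b) * u (i, a)) = u (j, b) * u (i, a) := by
    rw [← mul_assoc, hu.sq_commute, mul_assoc, hu.cube_eq]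
  have e3 : u (i, a) * u (i, a) * (u (j, a) * u (i, b)) = 0 := by
    rw [mul_assoc, ← mul_assoc (u (i, a)) (u (j, a)), hu.mul_eq_zero (p := (i, a)) (q := (j, a))
      ⟨by simp [hij], Or.inr rfl⟩, zero_mul, mul_zero]
  have e4 : u (i, a) * u (i, a) * (u (i, b) * u (j, a)) = 0 := by
    rw [mul_assoc, ← mul_assoc (u (i, a)) (u (i, b)), hu.mul_eq_zero (p := (i, a)) (q := (i, b))
      ⟨by simp [hab], Or.inl rfl⟩, zero_mul, mul_zero]
  simp only [mul_add, mul_sub, e1, e2, e3, e4, mul_zero] at h2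
  rw [← sub_eq_zero, ← h2]
  abel

/-- If the affine action formula defines half-commuting elements over the half-liberated cube, the
coordinates half-commute. -/
theorem InftyRel.starRel_of_tact (hu : InftyRel N A u)
    (h : ∀ i j k, tact u (cube (halfGen N)).coord i * tact u (cube (halfGen N)).coord j *
        tact u (cube (halfGen N)).coord k =
      tact u (cube (halfGen N)).coord k * tact u (cube (halfGen N)).coord j *
        tact u (cube (halfGen N)).coord i) : StarRel N A u := by
  have hz {p q : Fin N × Fin N} (h : Aligned p q) : u p * u q = 0 := hu.mul_eq_zero h
  refine ⟨hu.1, fun p q hp => hz hp, fun p q r => ?_⟩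
  by_cases hpq : p = q
  · rw [hpq, hu.sq_commute, mul_assoc]
  by_cases hqr : q = r
  · rw [hqr, hu.sq_commute, mul_assoc]
  by_cases hpr : p = r
  · rw [hpr]
  by_cases apq : Aligned p q
  · rw [hz apq, zero_mul, mul_assoc, hz apq.symm, mul_zero]
  by_cases aqr : Aligned q r
  · rw [mul_assoc, hz aqr, mul_zero, hz aqr.symm, zero_mul]
  by_cases apr : Aligned p r
  · rw [hu.2 _ _ _ apr, hu.2 _ _ _ apr.symm]
  obtain ⟨i, a⟩ := p
  obtain ⟨j, b⟩ := q
  obtain ⟨k, c⟩ := r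
  -- In the remaining case the three rows are pairwise distinct, and so are the three columns.
  simp only [Aligned, hpq, hqr, hpr, ne_eq, not_false_eq_true, true_and, not_or] at apq aqr apr
  let x (i : Fin N) : GroupCStar (HalfRefl N) := cubeScale N • groupUnit _ (halfGen N i)
  have h0 : tact u x i * tact u x j * tact u x k - tact u x k * tact u x j * tact u x i = 0 :=
    sub_eq_zero.2 (h i j k)
  rw [tact_mul_mul, tact_mul_mul] at h0
  simp only [← Fintype.sum_prod_type'] at h0
  rw [← Finset.sum_sub_distrib] at h0
  have hcoord (c d e : Fin N) : x c * x d * x e = (cubeScale N * cubeScale N * cubeScale N) •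
        groupUnit (HalfRefl N) (halfGen N c * halfGen N d * halfGen N e) := by
    rw [map_mul, map_mul, ← smul_mul_smul_comm, ← smul_mul_smul_comm]
  simp only [hcoord, ctmul_smul_right, ← smul_sub, ← ctmul_sub_left] at h0
  rw [← Finset.smul_sum, smul_eq_zero_iff_right (mul_ne_zero (mul_ne_zero (cubeScale_ne_zero i)
    (cubeScale_ne_zero i)) (cubeScale_ne_zero i))] at h0
  -- The point reflections `v ↦ e_i - v` are involutions, and three of them compose to `v ↦ e_i -
  -- e_j + e_k - v`, symmetric in `i` and `k`; so they define an action of `ℤ_2^{∘N}`.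
  obtain ⟨σ, hσ⟩ := exists_halfLift
    (fun i => Equiv.subLeft (Pi.single i (1 : ZMod 3) : Fin N → ZMod 3))
    (fun i => by ext1 v; simp) (fun i j k => by ext1 v; simp; abel)
  have h1 := sum_ite_eq_zero_of_tensor h0 σ 0
    (Pi.single a 1 - (Pi.single b 1 - (Pi.single c 1 - 0)))
  simp only [map_mul, hσ, Equiv.Perm.mul_apply, Equiv.subLeft_apply,
    single_sub_eq_iff apq.2 apr.2 aqr.2, Prod.mk.eta] at h1
  rw [← Finset.sum_filter, Finset.filter_or, Finset.filter_eq', Finset.filter_eq',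
    if_pos (Finset.mem_univ _), if_pos (Finset.mem_univ _),
    show ({(a, b, c)} ∪ {(c, b, a)} : Finset (Fin N × Fin N × Fin N)) = {(a, b, c), (c, b, a)}
      from rfl, Finset.sum_pair (by simp [apr.2])] at h1
  -- As in the commutative case, `u_ia^2` keeps the two monomials in `u_ia, u_jb, u_kc` and kills
  -- those with `u_ka` and `u_ic`.
  have h2 := congrArg (u (i, a) * u (i, a) * ·) h1
  have e1 : u (i, a) * u (i, a) * (u (i, a) * u (j, b) * u (k, c)) =
      u (i, a) * u (j, b) * u (k, c) := by
    rw [← mul_assoc, ← mul_assoc, hu.cube_eq]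
  have e2 : u (i, a) * u (i, a) * (u (k, c) * u (j, b) * u (i, a)) =
      u (k, c) * u (j, b) * u (i, a) := by
    rw [← mul_assoc, ← mul_assoc, hu.sq_commute, mul_assoc (u (k, c)), hu.sq_commute]
    simp only [mul_assoc]
    rw [← mul_assoc (u (i, a)), hu.cube_eq]
  have e3 : u (i, a) * u (i, a) * (u (k, a) * u (j, b) * u (i, c)) = 0 := by
    rw [mul_assoc (u (k, a)), mul_assoc (u (i, a)), ← mul_assoc (u (i, a)) (u (k, a)),
      hz (p := (i, a)) (q := (k, a)) ⟨by simp [apr.1], Or.inr rfl⟩, zero_mul, mul_zero]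
  have e4 : u (i, a) * u (i, a) * (u (i, c) * u (j, b) * u (k, a)) = 0 := by
    rw [mul_assoc (u (i, c)), mul_assoc (u (i, a)), ← mul_assoc (u (i, a)) (u (i, c)),
      hz (p := (i, a)) (q := (i, c)) ⟨by simp [apr.2], Or.inl rfl⟩, zero_mul, mul_zero]
  simp only [mul_add, mul_sub, e1, e2, e3, e4, mul_zero] at h2
  rw [← sub_eq_zero, ← h2]
  abel

end Maximality

/-! ### Words -/

section Words

variable {α : Type} [DecidableEq α] {M : Type} [Monoid M]

/-- Left multiplication by an involution of a reduced word. -/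
def cancelCons (a : α) : List α → List α
  | [] => [a]
  | b :: t => if a = b then t else a :: b :: t

/-- The reduced form of a word in involutions. -/
def reduceWord (l : List α) : List α := l.foldr cancelCons []

theorem isChain_cancelCons (a : α) {l : List α} (h : l.IsChain (· ≠ ·)) :
    (cancelCons a l).IsChain (· ≠ ·) := by
  cases l with
  | nil => exact List.isChain_singleton a
  | cons b t =>
    rw [cancelCons]
    split_ifs with hab
    · exact h.tail
    · exact List.isChain_cons_cons.2 ⟨hab, h⟩

/-- Reducedness matters when the head `a` is cancelled: the next letter then differs from `a`, so
the second application puts `a` back. -/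
theorem cancelCons_cancelCons (a : α) {l : List α} (h : l.IsChain (· ≠ ·)) :
    cancelCons a (cancelCons a l) = l := by
  cases l with
  | nil => simp [cancelCons]
  | cons b t =>
    by_cases hab : a = b
    · subst hab
      cases t with
      | nil => simp [cancelCons]
      | cons c t => simp [cancelCons, (List.isChain_cons_cons.1 h).1]
    · simp [cancelCons, hab]

/-- The reduced words. -/
abbrev RedWord (α : Type) : Type := {l : List α // l.IsChain (· ≠ ·)}

/-- The action of a generator on reduced words. -/
def cancelPerm (a : α) : Equiv.Perm (RedWord α) where
  toFun l := ⟨cancelCons a l.1, isChain_cancelCons a l.2⟩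
  invFun l := ⟨cancelCons a l.1, isChain_cancelCons a l.2⟩
  left_inv l := Subtype.ext (cancelCons_cancelCons a l.2)
  right_inv l := Subtype.ext (cancelCons_cancelCons a l.2)

theorem cancelPerm_mul_self (a : α) : cancelPerm a * cancelPerm a = 1 := by
  ext1 l
  exact Subtype.ext (cancelCons_cancelCons a l.2)

/-- The reduced form of a word is determined by the element of the free product. -/
theorem reduceWord_eq_of_prod_eq {N : ℕ} {w w' : List (Fin N)}
    (h : (w.map (freeGen N)).prod = (w'.map (freeGen N)).prod) : reduceWord w = reduceWord w' := by
  -- Van der Waerden's trick: the free product acts on reduced words, and a word applied to the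
  -- empty word yields its own reduced form.
  obtain ⟨σ, hσ⟩ := exists_freeLift (N := N) cancelPerm cancelPerm_mul_self
  have key (w : List (Fin N)) :
      (σ (w.map (freeGen N)).prod ⟨[], List.isChain_nil⟩).1 = reduceWord w := by
    induction w with
    | nil => simp [reduceWord]
    | cons a t ih =>
      rw [List.map_cons, List.prod_cons, map_mul, hσ, Equiv.Perm.mul_apply]
      exact congrArg (cancelCons a) ih
  rw [← key w, h, key w']

/-- Each cancellation during reduction removes a pair `aa`, whose image is a central square and
moves to the front. The list `m` records the cancelled letters, hence the factor 2 in the count. -/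
theorem exists_squares (x : α → M) (hx : ∀ a b, Commute (x a * x a) (x b)) (w : List α) :
    ∃ m : List α, (∀ a, w.count a = 2 * m.count a + (reduceWord w).count a) ∧
      (w.map x).prod = (m.map fun a => x a * x a).prod * ((reduceWord w).map x).prod := by
  induction w with
  | nil => exact ⟨[], by simp [reduceWord]⟩
  | cons a t ih =>
    obtain ⟨m, hc, hp⟩ := ih
    have hcomm : Commute (x a) (m.map fun a => x a * x a).prod := by
      refine Commute.list_prod_right _ _ fun y hy => ?_
      obtain ⟨b, -, rfl⟩ := List.mem_map.1 hy
      exact (hx b a).symm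
    have hred : reduceWord (a :: t) = cancelCons a (reduceWord t) := rfl
    have h1 : ((a :: t).map x).prod =
        (m.map fun a => x a * x a).prod * (x a * ((reduceWord t).map x).prod) := by
      rw [List.map_cons, List.prod_cons, hp, ← mul_assoc, hcomm.eq, mul_assoc]
    rw [hred, h1]
    rcases hr : reduceWord t with _ | ⟨b, r⟩
    · refine ⟨m, fun c => ?_, by simp [cancelCons]⟩
      have := hc c
      rw [hr] at this
      simp only [List.count_cons, cancelCons, this, List.count_nil]
      omega
    · have hc' := hc
      rw [hr] at hc'
      by_cases hab : a = b
      · subst hab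
        refine ⟨a :: m, fun c => ?_, ?_⟩
        · have := hc' c
          simp only [List.count_cons] at this
          simp only [cancelCons, List.count_cons, this, if_true]
          split_ifs <;> omega
        · simp only [cancelCons, if_true, List.map_cons, List.prod_cons]
          rw [← mul_assoc (x a) (x a), ← mul_assoc, ((hcomm.mul_left hcomm).eq)]
      · refine ⟨m, fun c => ?_, by simp [cancelCons, hab]⟩
        have := hc' c
        simp only [List.count_cons] at this
        simp only [cancelCons, List.count_cons, this, hab, if_false]
        split_ifs <;> omega

/-- When the squares are central, a product only depends on the letters and on the reduced word. -/
theorem prod_eq_of_reduceWord_eq {x : α → M} (hx : ∀ a b, Commute (x a * x a) (x b))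
    {w w' : List α} (hp : w.Perm w') (hr : reduceWord w = reduceWord w') :
    (w.map x).prod = (w'.map x).prod := by
  obtain ⟨m, hc, h⟩ := exists_squares x hx w
  obtain ⟨m', hc', h'⟩ := exists_squares x hx w'
  -- Equal letter counts and equal reduced words force equal counts of cancelled pairs; the squares
  -- commute, so their order is irrelevant.
  have hm : m.Perm m' := List.perm_iff_count.2 fun a => by
    have h1 := hc a
    have h2 := hc' a
    rw [hp.count_eq a, hr] at h1
    omega
  rw [h, h', hr, (hm.map _).prod_eq' ?_]
  refine List.pairwise_map.2 (List.pairwise_of_forall fun a b => ?_)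
  exact (hx a b).mul_right (hx a b)

/-- The letters at odd and at even positions of a word. -/
def splitWord : List α → List α × List α
  | [] => ([], [])
  | a :: t => (a :: (splitWord t).2, (splitWord t).1)

theorem count_splitWord (w : List α) (a : α) :
    (splitWord w).1.count a + (splitWord w).2.count a = w.count a := by
  induction w with
  | nil => rfl
  | cons b t ih =>
    simp only [splitWord, List.count_cons]
    omega

/-- The relation `abc = cba` exchanges letters two places apart, so a letter at an odd position can
travel to the front. The roles of odd and even positions swap in the tail `t`, whence the crossed
components. -/
theorem exists_front {x : α → M} (hx : ∀ a b c, x a * x b * x c = x c * x b * x a) (a : α) (n : ℕ)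
    (w : List α) (hn : w.length ≤ n) (ha : a ∈ (splitWord w).1) :
    ∃ t, (w.map x).prod = ((a :: t).map x).prod ∧ (splitWord w).1.Perm (a :: (splitWord t).2) ∧
      (splitWord w).2.Perm (splitWord t).1 := by
  induction n using Nat.strong_induction_on generalizing w with
  | _ n ih =>
  rcases w with _ | ⟨c, _ | ⟨d, t⟩⟩
  · simp [splitWord] at ha
  · simp only [splitWord, List.mem_singleton] at ha
    subst ha
    exact ⟨[], rfl, List.Perm.refl _, List.Perm.refl _⟩
  · by_cases hac : a = c
    · subst hac
      exact ⟨d :: t, rfl, List.Perm.refl _, List.Perm.refl _⟩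
    · simp only [splitWord, List.mem_cons, hac, false_or] at ha
      simp only [List.length_cons] at hn
      -- Bring `a` to the front of the tail, then rewrite `c d a s` as `a d c s`.
      obtain ⟨s, h1, h2, h3⟩ := ih (n - 2) (by omega) t (by omega) ha
      refine ⟨d :: c :: s, ?_, ?_, ?_⟩
      · simp only [List.map_cons, List.prod_cons] at h1 ⊢
        rw [h1]
        simp only [← mul_assoc]
        rw [hx]
      · exact (h2.cons c).trans (List.Perm.swap _ _ _)
      · exact h3.cons d

/-- For half-commuting elements, a product only depends on the letters at odd positions and on
those at even positions. -/
theorem prod_eq_of_splitWord_perm {x : α → M} (hx : ∀ a b c, x a * x b * x c = x c * x b * x a)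
    {w w' : List α} (h1 : (splitWord w).1.Perm (splitWord w').1)
    (h2 : (splitWord w).2.Perm (splitWord w').2) : (w.map x).prod = (w'.map x).prod := by
  induction w generalizing w' with
  | nil =>
    cases w' with
    | nil => rfl
    | cons b t => simp [splitWord] at h1
  | cons a t ih =>
    -- The head of `w` sits at an odd position of `w'`, so it can be brought to the front and
    -- removed from both words.
    obtain ⟨s, e1, e2, e3⟩ := exists_front hx a _ w' le_rfl (h1.subset (by simp [splitWord]))
    rw [e1, List.map_cons, List.prod_cons, List.map_cons, List.prod_cons]
    congr 1
    exact ih (h2.trans e3) ((List.perm_cons a).1 (h1.trans e2))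

/-- The element of `ℤ_2^{∘N}` given by a word determines the differences between the multiplicities
of the letters at odd and at even positions. -/
theorem splitWord_count_of_prod_eq {N : ℕ} {w w' : List (Fin N)}
    (h : (w.map (halfGen N)).prod = (w'.map (halfGen N)).prod) (a : Fin N) :
    ((splitWord w).1.count a : ℤ) - (splitWord w).2.count a =
      (splitWord w').1.count a - (splitWord w').2.count a := by
  -- Reflections `v ↦ e_i - v` again, now over `ℤ` since exact multiplicities are wanted: applied to
  -- `0`, a word gives the alternating sum of its letters.
  obtain ⟨σ, hσ⟩ := exists_halfLift
    (fun i => Equiv.subLeft (Pi.single i (1 : ℤ) : Fin N → ℤ))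
    (fun i => by ext1 v; simp) (fun i j k => by ext1 v; simp; abel)
  have key (w : List (Fin N)) : σ (w.map (halfGen N)).prod 0 a =
      ((splitWord w).1.count a : ℤ) - (splitWord w).2.count a := by
    induction w with
    | nil => simp [splitWord]
    | cons b t ih =>
      rw [List.map_cons, List.prod_cons, map_mul, hσ, Equiv.Perm.mul_apply, Equiv.subLeft_apply,
        Pi.sub_apply, ih]
      simp only [splitWord, List.count_cons, Pi.single_apply]
      by_cases hab : a = b
      · subst hab; simp; ring
      · simp [hab, Ne.symm hab]
  rw [← key w, h, key w']

theorem wordProd_eq_map_prod {N k : ℕ} (y : Fin N → M) (i : Fin k → Fin N) :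
    wordProd y i = ((List.ofFn i).map y).prod := by
  rw [wordProd, List.map_ofFn]
  rfl

/-- Each block carries a single label and has as many upper as lower legs, so counting letters block
by block gives the same multiset on both rows. -/
theorem perm_of_isVert {N k : ℕ} {π : Setoid (Fin k ⊕ Fin k)} (hπ : IsVert π)
    {i j : Fin k → Fin N} (h : KerLE i j π) : (List.ofFn i).Perm (List.ofFn j) := by
  classical
  let _ : Fintype (Quotient π) := Fintype.ofFinite _
  let label : Quotient π → Fin N := Quotient.lift (Sum.elim i j) h
  have hsum (e : Fin k → Quotient π) : ((List.ofFn fun r => label (e r) : List (Fin N)) :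
      Multiset (Fin N)) = ∑ q, (Finset.univ.filter fun r => e r = q).card • {label q} := by
    calc ((List.ofFn fun r => label (e r) : List (Fin N)) : Multiset (Fin N))
        = ∑ r, {label (e r)} := by
          rw [← Fin.univ_val_map, ← Multiset.sum_map_singleton (Multiset.map _ _),
            Multiset.map_map]
          rfl
      _ = ∑ q, ∑ r with e r = q, {label (e r)} := (Finset.sum_fiberwise _ _ _).symm
      _ = _ := Finset.sum_congr rfl fun q _ => by
          rw [← Finset.sum_const]
          exact Finset.sum_congr rfl fun r hr => by rw [(Finset.mem_filter.1 hr).2]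
  have hcard (q : Quotient π) : (Finset.univ.filter fun r => ⟦Sum.inl r⟧ = q).card =
      (Finset.univ.filter fun r => ⟦Sum.inr r⟧ = q).card := by
    obtain ⟨s, rfl⟩ := Quotient.exists_rep q
    have := hπ s
    rw [Set.ncard_eq_toFinset_card', Set.ncard_eq_toFinset_card'] at this
    simpa only [Quotient.eq, Set.toFinset_ofPred] using this
  rw [← Multiset.coe_eq_coe]
  refine (hsum fun r => ⟦Sum.inl r⟧).trans (Eq.trans ?_ (hsum fun r => ⟦Sum.inr r⟧).symm)
  exact Finset.sum_congr rfl fun q _ => by rw [hcard]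

end Words

/-! ### Spheres associated to groups -/

section GroupSpheres

variable {N : ℕ} {A : Type} [CStarAlgebra A]

/-- The relations of the sphere associated to a group. -/
def GroupSphereRel {Γ : Type} [Group Γ] (g : Fin N → Γ) : FamilyClass (Fin N) := fun C _ x =>
  FreeSphereRel N C x ∧ ∀ (k : ℕ) (π : Setoid (Fin k ⊕ Fin k)), IsVert π → IsGroupPartition g π →
    ∀ i j : Fin k → Fin N, KerLE i j π → wordProd x i = wordProd x j

/-- The partition joining the points with equal labels. -/
def labelPart {k m : ℕ} (p q : Fin k → Fin m) : Setoid (Fin k ⊕ Fin k) := Setoid.ker (Sum.elim p q)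

theorem isVert_labelPart {k m : ℕ} {p q : Fin k → Fin m}
    (h : ∀ l, (Finset.univ.filter fun r => p r = l).card =
      (Finset.univ.filter fun r => q r = l).card) : IsVert (labelPart p q) := by
  classical
  intro s
  have := h (Sum.elim p q s)
  change {r | p r = Sum.elim p q s}.ncard = {r | q r = Sum.elim p q s}.ncard
  rw [Set.ncard_eq_toFinset_card', Set.ncard_eq_toFinset_card']
  simpa only [Set.toFinset_ofPred] using this

theorem kerLE_labelPart {k m : ℕ} (p q : Fin k → Fin m) (v : Fin m → Fin N) :
    KerLE (v ∘ p) (v ∘ q) (labelPart p q) := by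
  intro s t h
  have h' : Sum.elim p q s = Sum.elim p q t := h
  rw [← Sum.comp_elim, Function.comp_apply, Function.comp_apply, h']

/-- Extracts one relation of the sphere from one explicit diagram: `p` and `q` label the legs of its
two rows by blocks, and `v` assigns coordinates to the blocks. -/
theorem GroupSphereRel.apply {Γ : Type} [Group Γ] {g : Fin N → Γ} {x : Fin N → A}
    (hx : GroupSphereRel g A x) {k m : ℕ} {p q : Fin k → Fin m}
    (hv : ∀ l, (Finset.univ.filter fun r => p r = l).card =
      (Finset.univ.filter fun r => q r = l).card)
    (hg : IsGroupPartition g (labelPart p q)) (v : Fin m → Fin N) :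
    wordProd x (v ∘ p) = wordProd x (v ∘ q) :=
  hx.2 _ _ (isVert_labelPart hv) hg _ _ (kerLE_labelPart p q v)

/-- Balanced blocks only equate permuted words, so partitions can be forgotten: it is enough to
treat permuted words with the same value in the group. -/
theorem GroupSphereRel.prod_eq {Γ : Type} [Group Γ] {g : Fin N → Γ} {x : Fin N → A}
    (hx : FreeSphereRel N A x) (h : ∀ w w' : List (Fin N), w.Perm w' →
      (w.map g).prod = (w'.map g).prod → (w.map x).prod = (w'.map x).prod) :
    GroupSphereRel g A x := by
  refine ⟨hx, fun k π hπ hg i j hij => ?_⟩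
  rw [wordProd_eq_map_prod, wordProd_eq_map_prod]
  refine h _ _ (perm_of_isVert hπ hij) ?_
  rw [← wordProd_eq_map_prod, ← wordProd_eq_map_prod]
  exact hg i j hij

theorem groupSphereRel_powGen_iff {x : Fin N → A} :
    GroupSphereRel (powGen N) A x ↔ RealSphereRel N A x := by
  constructor
  · refine fun hx => ⟨hx.1, fun a b => ?_⟩
    have := hx.apply (p := ![0, 1]) (q := ![1, 0]) (by decide) (fun i j h => by
      have h0 : i 0 = j 1 := h (Sum.inl 0) (Sum.inr 1) rfl
      have h1 : i 1 = j 0 := h (Sum.inl 1) (Sum.inr 0) rfl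
      simp [wordProd, List.ofFn_succ, h0, h1, mul_comm]) ![a, b]
    simpa [wordProd, List.ofFn_succ] using this
  · intro hx
    refine GroupSphereRel.prod_eq hx.1 fun w w' hw _ => (hw.map x).prod_eq' ?_
    exact List.pairwise_map.2 (List.pairwise_of_forall fun a b => hx.2 a b)

theorem groupSphereRel_halfGen_iff {x : Fin N → A} :
    GroupSphereRel (halfGen N) A x ↔ HalfSphereRel N A x := by
  constructor
  · refine fun hx => ⟨hx.1, fun a b c => ?_⟩
    have := hx.apply (p := ![0, 1, 2]) (q := ![2, 1, 0]) (by decide) (fun i j h => by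
      have h0 : i 0 = j 2 := h (Sum.inl 0) (Sum.inr 2) rfl
      have h1 : i 1 = j 1 := h (Sum.inl 1) (Sum.inr 1) rfl
      have h2 : i 2 = j 0 := h (Sum.inl 2) (Sum.inr 0) rfl
      have := halfGen_half (j 2) (j 1) (j 0)
      simpa [wordProd, List.ofFn_succ, h0, h1, h2, ← mul_assoc] using this) ![a, b, c]
    simpa [wordProd, List.ofFn_succ, ← mul_assoc] using this
  · intro hx
    refine GroupSphereRel.prod_eq hx.1 fun w w' hw hg => ?_
    have h1 (a : Fin N) := splitWord_count_of_prod_eq hg a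
    have h2 (a : Fin N) := count_splitWord w a
    have h3 (a : Fin N) := count_splitWord w' a
    have h4 (a : Fin N) := hw.count_eq a
    -- The sum and the difference of the odd and even multiplicities of each letter are known, hence
    -- both multiplicities.
    exact prod_eq_of_splitWord_perm hx.2
      (List.perm_iff_count.2 fun a => by have := h1 a; have := h2 a; have := h3 a; have := h4 a; omega)
      (List.perm_iff_count.2 fun a => by have := h1 a; have := h2 a; have := h3 a; have := h4 a; omega)

theorem groupSphereRel_freeGen_iff {x : Fin N → A} :
    GroupSphereRel (freeGen N) A x ↔ InftySphereRel N A x := by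
  constructor
  · refine fun hx => ⟨hx.1, fun a b => ?_⟩
    -- The diagram of `aab = baa`: one block with two upper and two lower legs, and one through
    -- string. It holds in the free product because `a^2 = 1`.
    have := hx.apply (p := ![0, 0, 1]) (q := ![1, 0, 0]) (by decide) (fun i j h => by
      have h0 : i 0 = i 1 := h (Sum.inl 0) (Sum.inl 1) rfl
      have h1 : i 2 = j 0 := h (Sum.inl 2) (Sum.inr 0) rfl
      have h2 : j 1 = j 2 := h (Sum.inr 1) (Sum.inr 2) rfl
      simp [wordProd, List.ofFn_succ, h0, h1, h2, freeGen_mul_self, ← mul_assoc]) ![a, b]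
    simpa [wordProd, List.ofFn_succ, ← mul_assoc, sq] using this
  · intro hx
    refine GroupSphereRel.prod_eq hx.1 fun w w' hw hg => ?_
    refine prod_eq_of_reduceWord_eq (fun a b => ?_) hw (reduceWord_eq_of_prod_eq hg)
    rw [← sq]
    exact hx.2 a b

theorem groupSphereRel_groupSphere {Γ : Type} [Group Γ] (g : Fin N → Γ) :
    GroupSphereRel g (groupSphere g).alg (groupSphere g).coord := by
  refine ⟨freeSphereRel_gen fun _ _ _ h => h.1, fun k π h1 h2 i j h3 => ?_⟩
  have := gen_list_prod_eq (R := GroupSphereRel g) (b := fun _ => 1) (l := List.ofFn i)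
    (l' := List.ofFn j) fun C _ v h => by
      have := h.2 k π h1 h2 i j h3
      rwa [wordProd_eq_map_prod, wordProd_eq_map_prod] at this
  rw [wordProd_eq_map_prod, wordProd_eq_map_prod]
  exact this

theorem groupSphere.exists_lift {Γ : Type} [Group Γ] {g : Fin N → Γ} {x : Fin N → A}
    (hx : GroupSphereRel g A x) :
    ∃ φ : (groupSphere g).alg →⋆ₐ[ℂ] A, ∀ i, φ ((groupSphere g).coord i) = x i :=
  exists_lift_univ (R := GroupSphereRel g) hx hx.1.norm_le

theorem halfSphere.exists_lift {x : Fin N → A} (hx : HalfSphereRel N A x) :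
    ∃ φ : (halfSphere N).alg →⋆ₐ[ℂ] A, ∀ i, φ ((halfSphere N).coord i) = x i :=
  exists_lift_univ hx hx.1.norm_le

theorem inftySphere.exists_lift {x : Fin N → A} (hx : InftySphereRel N A x) :
    ∃ φ : (inftySphere N).alg →⋆ₐ[ℂ] A, ∀ i, φ ((inftySphere N).coord i) = x i :=
  exists_lift_univ hx hx.1.norm_le

theorem groupSphere_powGen_same : Same (groupSphere (powGen N)) (realSphere N) := by
  obtain ⟨φ, hφ⟩ := groupSphere.exists_lift
    (groupSphereRel_powGen_iff.2 (realSphereRel_realSphere (N := N)))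
  obtain ⟨ψ, hψ⟩ := realSphere.exists_lift
    (groupSphereRel_powGen_iff.1 (groupSphereRel_groupSphere (powGen N)))
  exact Same.of_homs (generates_univ _) generates_realSphere φ hφ ψ hψ

theorem groupSphere_halfGen_same : Same (groupSphere (halfGen N)) (halfSphere N) := by
  obtain ⟨φ, hφ⟩ := groupSphere.exists_lift
    (groupSphereRel_halfGen_iff.2 (halfSphereRel_halfSphere (N := N)))
  obtain ⟨ψ, hψ⟩ := halfSphere.exists_lift
    (groupSphereRel_halfGen_iff.1 (groupSphereRel_groupSphere (halfGen N)))
  exact Same.of_homs (generates_univ _) (generates_univ _) φ hφ ψ hψ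

theorem groupSphere_freeGen_same : Same (groupSphere (freeGen N)) (inftySphere N) := by
  obtain ⟨φ, hφ⟩ := groupSphere.exists_lift
    (groupSphereRel_freeGen_iff.2 (inftySphereRel_inftySphere (N := N)))
  obtain ⟨ψ, hψ⟩ := inftySphere.exists_lift
    (groupSphereRel_freeGen_iff.1 (groupSphereRel_groupSphere (freeGen N)))
  exact Same.of_homs (generates_univ _) (generates_univ _) φ hφ ψ hψ

end GroupSpheres

/-! ### Inclusions -/

section Inclusions

variable {N : ℕ}

theorem realSphere_isSubspace_halfSphere : IsSubspace (realSphere N) (halfSphere N) := by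
  have h := realSphereRel_realSphere (N := N)
  obtain ⟨φ, hφ⟩ := halfSphere.exists_lift (x := (realSphere N).coord) ⟨h.1, fun i j k => by
    rw [h.2 i j, mul_assoc, h.2 i k, ← mul_assoc, h.2 j k]⟩
  exact IsSubspace.of_hom generates_realSphere φ hφ

/-- Half-commutation with the first two letters equal is exactly the centrality of squares. -/
theorem halfSphere_isSubspace_inftySphere : IsSubspace (halfSphere N) (inftySphere N) := by
  have h := halfSphereRel_halfSphere (N := N)
  obtain ⟨φ, hφ⟩ := inftySphere.exists_lift (x := (halfSphere N).coord) ⟨h.1, fun i j => by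
    rw [sq, h.2 i i j, mul_assoc]⟩
  exact IsSubspace.of_hom (generates_univ _) φ hφ

theorem powCube_isSubspace_halfCube : IsSubspace (cube (powGen N)) (cube (halfGen N)) := by
  obtain ⟨φ, hφ⟩ := exists_halfLift (powGen N) powGen_mul_self fun i j k => by
    rw [mul_comm (powGen N i), mul_assoc, mul_comm (powGen N i), ← mul_assoc,
      mul_comm (powGen N j)]
  exact cube_isSubspace_cube closure_powGen φ hφ

theorem halfCube_isSubspace_freeCube : IsSubspace (cube (halfGen N)) (cube (freeGen N)) := by
  obtain ⟨φ, hφ⟩ := exists_freeLift (halfGen N) halfGen_mul_self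
  exact cube_isSubspace_cube closure_halfGen φ hφ

theorem powCube_isSubspace_realSphere (hN : 1 ≤ N) :
    IsSubspace (cube (powGen N)) (realSphere N) := by
  obtain ⟨φ, hφ⟩ := realSphere.exists_lift
    ⟨(cubeRel_cube (powGen_mul_self (N := N))).freeSphereRel hN, powCube_comm⟩
  exact IsSubspace.of_hom (generates_cube closure_powGen) φ hφ

theorem halfCube_isSubspace_halfSphere (hN : 1 ≤ N) :
    IsSubspace (cube (halfGen N)) (halfSphere N) := by
  obtain ⟨φ, hφ⟩ := halfSphere.exists_lift
    ⟨(cubeRel_cube (halfGen_mul_self (N := N))).freeSphereRel hN, halfCube_half⟩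
  exact IsSubspace.of_hom (generates_cube closure_halfGen) φ hφ

theorem freeCube_isSubspace_inftySphere (hN : 1 ≤ N) :
    IsSubspace (cube (freeGen N)) (inftySphere N) := by
  obtain ⟨φ, hφ⟩ := inftySphere.exists_lift
    ((cubeRel_cube (freeGen_mul_self (N := N))).inftySphereRel hN)
  exact IsSubspace.of_hom (generates_cube closure_freeGen) φ hφ

end Inclusions

/-! ### Quantum reflection groups -/

section ReflectionGroups

variable {N : ℕ} {X Z : NCSpace (Fin N)} {K : NCSpace (Fin N × Fin N)}

theorem inftyRel_of_isSubspace (h : IsSubspace K (HInfty N)) : InftyRel N K.alg K.coord := by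
  obtain ⟨φ, -, hφ⟩ := h
  have := inftyRel_HInfty.map φ
  rwa [funext hφ] at this

/-- Only the space leg is restricted to `Z`, so no action on `Z` is claimed; still, every relation
of `X` holds for the elements `∑_j u_ij ⊗ z_j`. With `Z` a cube, this treats a sphere and its cube
at once. -/
theorem ActsOn.exists_hom (h : ActsOn K X) (hZ : IsSubspace Z X) :
    ∃ Φ : X.alg →⋆ₐ[ℂ] CTensor K.alg Z.alg, ∀ i, Φ (X.coord i) = tact K.coord Z.coord i := by
  obtain ⟨Φ, hΦ⟩ := h
  obtain ⟨φ, -, hφ⟩ := hZ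
  obtain ⟨T, hT⟩ := exists_tensorMap (StarAlgHom.id ℂ K.alg) φ
  exact ⟨T.comp Φ, fun i => by simp [hΦ, hT, hφ, tact]⟩

theorem IsLargestActing.isQuantumReflectionGroup {G : NCSpace (Fin N × Fin N)}
    (h : IsLargestActing (HInfty N) X G) : IsQuantumReflectionGroup X G :=
  ⟨h, fun _ hK => h.same_inter isQuantumGroup_HInfty hK⟩

theorem isLargestActing_HInfty (h : ActsOn (HInfty N) X) :
    IsLargestActing (HInfty N) X (HInfty N) :=
  ⟨isQuantumGroup_HInfty, IsSubspace.refl _, h, fun _ _ h _ => h⟩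

/-- The half-commutation of `X`, transported by the action and tested on the cube inside `X`, forces
that of the entries of `K`. Both the half-liberated sphere and its cube satisfy the hypotheses. -/
theorem isLargestActing_HStar (h : ActsOn (HStar N) X) (hZ : IsSubspace (cube (halfGen N)) X)
    (hX : ∀ i j k, X.coord i * X.coord j * X.coord k = X.coord k * X.coord j * X.coord i) :
    IsLargestActing (HInfty N) X (HStar N) := by
  refine ⟨isQuantumGroup_HStar, HStar_isSubspace_HInfty, h, fun K hK hKM hKX => ?_⟩
  obtain ⟨Φ, hΦ⟩ := hKX.exists_hom hZ
  obtain ⟨φ, hφ⟩ := HStar.exists_lift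
    ((inftyRel_of_isSubspace hKM).starRel_of_tact fun i j k => by
      simp only [← hΦ, ← map_mul, hX i j k])
  exact IsSubspace.of_hom hK.generates φ hφ

theorem isLargestActing_HClassical (h : ActsOn (HClassical N) X)
    (hZ : IsSubspace (cube (powGen N)) X)
    (hX : ∀ i j, X.coord i * X.coord j = X.coord j * X.coord i) :
    IsLargestActing (HInfty N) X (HClassical N) := by
  refine ⟨isQuantumGroup_HClassical, HClassical_isSubspace_HStar.trans HStar_isSubspace_HInfty, h,
    fun K hK hKM hKX => ?_⟩
  obtain ⟨Φ, hΦ⟩ := hKX.exists_hom hZ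
  obtain ⟨φ, hφ⟩ := HClassical.exists_lift
    ((inftyRel_of_isSubspace hKM).classRel_of_tact fun i j => by
      simp only [← hΦ, ← map_mul, hX i j])
  exact IsSubspace.of_hom hK.generates φ hφ

theorem HClassical_actsOn_realSphere : ActsOn (HClassical N) (realSphere N) :=
  realSphere.exists_lift ⟨tact_freeSphereRel classRel_HClassical.1 realSphereRel_realSphere.1,
    tact_comm classRel_HClassical.2.2 realSphereRel_realSphere.2⟩

theorem HStar_actsOn_halfSphere : ActsOn (HStar N) (halfSphere N) :=
  halfSphere.exists_lift ⟨tact_freeSphereRel starRel_HStar.1 halfSphereRel_halfSphere.1,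
    tact_half starRel_HStar.2.2 halfSphereRel_halfSphere.2⟩

theorem HInfty_actsOn_inftySphere : ActsOn (HInfty N) (inftySphere N) :=
  inftySphere.exists_lift (tact_inftySphereRel inftyRel_HInfty inftySphereRel_inftySphere)

theorem HClassical_actsOn_powCube : ActsOn (HClassical N) (cube (powGen N)) :=
  powCube.exists_lift ((cubeRel_cube powGen_mul_self).tact classRel_HClassical.starRel.inftyRel)
    (tact_comm classRel_HClassical.2.2 powCube_comm)

theorem HStar_actsOn_halfCube : ActsOn (HStar N) (cube (halfGen N)) :=
  halfCube.exists_lift ((cubeRel_cube halfGen_mul_self).tact starRel_HStar.inftyRel)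
    (tact_half starRel_HStar.2.2 halfCube_half)

theorem HInfty_actsOn_freeCube : ActsOn (HInfty N) (cube (freeGen N)) :=
  freeCube.exists_lift ((cubeRel_cube freeGen_mul_self).tact inftyRel_HInfty)

end ReflectionGroups

theorem proposition5p5 (N : ℕ) (hN : 1 ≤ N) :
    -- the spheres associated to the basic reflection groups
    (NCSpace.Same (groupSphere (powGen N)) (realSphere N) ∧
      NCSpace.Same (groupSphere (halfGen N)) (halfSphere N) ∧
      NCSpace.Same (groupSphere (freeGen N)) (inftySphere N)) ∧
    -- the inclusions between spheres, between cubes, and of the cubes into the spheres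
    (NCSpace.IsSubspace (realSphere N) (halfSphere N) ∧ NCSpace.IsSubspace (halfSphere N) (inftySphere N)) ∧
    (NCSpace.IsSubspace (cube (powGen N)) (cube (halfGen N)) ∧
      NCSpace.IsSubspace (cube (halfGen N)) (cube (freeGen N))) ∧
    (NCSpace.IsSubspace (cube (powGen N)) (realSphere N) ∧
      NCSpace.IsSubspace (cube (halfGen N)) (halfSphere N) ∧
      NCSpace.IsSubspace (cube (freeGen N)) (inftySphere N)) ∧
    -- the quantum reflection groups of the spheres
    (IsQuantumReflectionGroup (realSphere N) (HClassical N) ∧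
      IsQuantumReflectionGroup (halfSphere N) (HStar N) ∧
      IsQuantumReflectionGroup (inftySphere N) (HInfty N)) ∧
    -- the quantum reflection groups of the cubes
    (IsQuantumReflectionGroup (cube (powGen N)) (HClassical N) ∧
      IsQuantumReflectionGroup (cube (halfGen N)) (HStar N) ∧
      IsQuantumReflectionGroup (cube (freeGen N)) (HInfty N)) ∧
    -- the inclusions between the quantum reflection groups
    (NCSpace.IsSubspace (HClassical N) (HStar N) ∧ NCSpace.IsSubspace (HStar N) (HInfty N)) := by
  exact ⟨⟨groupSphere_powGen_same, groupSphere_halfGen_same, groupSphere_freeGen_same⟩,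
    ⟨realSphere_isSubspace_halfSphere, halfSphere_isSubspace_inftySphere⟩,
    ⟨powCube_isSubspace_halfCube, halfCube_isSubspace_freeCube⟩,
    ⟨powCube_isSubspace_realSphere hN, halfCube_isSubspace_halfSphere hN,
      freeCube_isSubspace_inftySphere hN⟩,
    ⟨(isLargestActing_HClassical HClassical_actsOn_realSphere (powCube_isSubspace_realSphere hN)
        realSphereRel_realSphere.2).isQuantumReflectionGroup,
      (isLargestActing_HStar HStar_actsOn_halfSphere (halfCube_isSubspace_halfSphere hN)
        halfSphereRel_halfSphere.2).isQuantumReflectionGroup,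
      (isLargestActing_HInfty HInfty_actsOn_inftySphere).isQuantumReflectionGroup⟩,
    ⟨(isLargestActing_HClassical HClassical_actsOn_powCube (IsSubspace.refl _)
        powCube_comm).isQuantumReflectionGroup,
      (isLargestActing_HStar HStar_actsOn_halfCube (IsSubspace.refl _)
        halfCube_half).isQuantumReflectionGroup,
      (isLargestActing_HInfty HInfty_actsOn_freeCube).isQuantumReflectionGroup⟩,
    HClassical_isSubspace_HStar, HStar_isSubspace_HInfty⟩

end
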